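/- Theorem (LoRA excess risk, underdetermined regime). There is an absolute constant $C$ such that the following holds. Let $r<n<d_x$ and $d_y$ be nonnegative integers. Let $\mathbf x\in\mathbb R^{d_x}$ be a random vector with $\mathbb E\|\mathbf x\|^2<\infty$ and with $\Sigma_{xx}:=\mathbb E[\mathbf x\mathbf x^\top]$ of full rank, let $\varepsilon\sim\mathcal N(0,\Sigma_{\varepsilon\varepsilon})$ in $\mathbb R^{d_y}$, with $\Sigma_{\varepsilon\varepsilon}\succeq 0$, be independent of $\mathbf x$, and let $\mathbf y=A^\star\mathbf x+\varepsilon$ with $A^\star\in\mathbb R^{d_y\times d_x}$. Let $(\mathbf x_1,\mathbf y_1),\dots,(\mathbf x_n,\mathbf y_n)$ be i.i.d. copies of $(\mathbf x,\mathbf y)$, and put $X=[\mathbf x_1,\dots,\mathbf x_n]$, $Y=[\mathbf y_1,\dots,\mathbf y_n]$, $\widehat\Sigma_{xx}=\frac1n XX^\top$. For $A_0\in\mathbb R^{d_y\times d_x}$ let $\Delta^\star=A^\star-A_0$ and $$\widehat\Delta_{\rm FFT}=(Y-A_0X)X^\dagger,\qquad \widehat A_{\rm LoRA}=A_0+\big[\widehat\Delta_{\rm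 FFT}\widehat\Sigma_{xx}^{1/2}\big]_r\big(\widehat\Sigma_{xx}^{1/2}\big)^\dagger,$$ where $^\dagger$ is the Moore–Penrose inverse and $[M]_r$ is a top-$r$ singular value truncation of $M$ (any one, if there are several). Let $\mathcal R(A)=\mathbb E\|A\mathbf x-\mathbf y\|^2$, where for $A=\widehat A_{\rm LoRA}$ the expectation is over a new pair $(\mathbf x,\mathbf y)$ independent of the training data. Let $P_X^\perp$ be the orthogonal projection onto the orthogonal complement of the column space of $X$, let $\sigma_1\ge\sigma_2\ge\dots$ denote singular values ($\sigma_i=0$ beyond the size of the matrix), and $\lambda_{\max}$ the largest eigenvalue. Then, in $[0,\infty]$ with the convention $0\cdot\infty=0$, $$\begin{aligned}\mathbb E\big[\mathcal R(\widehat A_{\rm LoRA})\big]-\mathcal R(A^\star)\le C\Big(&\mathbb E\big[\|\Delta^\star P_X^\perp\Sigma_{xx}^{1/2}\|_F^2\big]+\frac{r\max\{n,d_y\}}{n}\,\lambda_{\max}(\Sigma_{\varepsilon\varepsilon})\,\mathbb E\big[\lambda_{\max}(\Sigma_{xx}\widehat\Sigma_{xx}^\dagger)\big]\\&+\lambda_{\max}(\Sigma_{xx})\Big(r\,\sigma_{r+1}^2(\Delta^\star)+\sum_{i=r+1}^{\min\{n,d_y\}}\sigma_i^2(\Delta^\star)\Big)\\&+r\,\sigma_{r+1}^2(\Delta^\star)\,\mathbb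 E\big[\lambda_{\max}(\widehat\Sigma_{xx})\,\lambda_{\max}(\Sigma_{xx}\widehat\Sigma_{xx}^\dagger)\big]\Big).\end{aligned}$$ -/

import Mathlib

open MeasureTheory ProbabilityTheory
open scoped Matrix MatrixOrder ENNReal NNReal

namespace LoRA

/-! ### Matrix notions -/

/-- The four Penrose equations: `B` is the Moore-Penrose inverse of the real matrix `A`. -/
structure IsMoorePenrose {m n : ℕ} (A : Matrix (Fin m) (Fin n) ℝ)
    (B : Matrix (Fin n) (Fin m) ℝ) : Prop where
  mul_mul_left : A * B * A = A
  mul_mul_right : B * A * B = B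
  symm_left : (A * B)ᵀ = A * B
  symm_right : (B * A)ᵀ = B * A

/-- The Moore-Penrose inverse `A† = (AᵀA)† Aᵀ` of a real matrix, where the Moore-Penrose inverse
of the symmetric matrix `AᵀA` inverts its nonzero eigenvalues and keeps its zero eigenvalues
(recall that `0⁻¹ = 0`). By `isMoorePenrose_pinv` and `IsMoorePenrose.eq_pinv` it is the unique
solution of the Penrose equations. -/
noncomputable def pinv {m n : ℕ} (A : Matrix (Fin m) (Fin n) ℝ) : Matrix (Fin n) (Fin m) ℝ :=
  cfc (fun t : ℝ => t⁻¹) (Aᵀ * A) * Aᵀ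

theorem isMoorePenrose_pinv {m n : ℕ} (A : Matrix (Fin m) (Fin n) ℝ) :
    IsMoorePenrose A (pinv A) := by
  have hS : IsSelfAdjoint (Aᵀ * A) := by
    have := Matrix.isHermitian_conjTranspose_mul_self A
    rwa [Matrix.conjTranspose_eq_transpose_of_trivial] at this
  have hSt : (Aᵀ * A)ᵀ = Aᵀ * A := by simp
  have hdef : pinv A = cfc (fun t : ℝ => t⁻¹) (Aᵀ * A) * Aᵀ := rfl
  have hfin : (spectrum ℝ (Aᵀ * A)).Finite := Matrix.finite_real_spectrum
  have hGt : (cfc (fun t : ℝ => t⁻¹) (Aᵀ * A))ᵀ = cfc (fun t : ℝ => t⁻¹) (Aᵀ * A) := by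
    have h : IsSelfAdjoint (cfc (fun t : ℝ => t⁻¹) (Aᵀ * A)) := cfc_predicate _ _
    have h2 : (cfc (fun t : ℝ => t⁻¹) (Aᵀ * A))ᴴ = _ := h
    rwa [Matrix.conjTranspose_eq_transpose_of_trivial] at h2
  have hid : cfc (fun t : ℝ => t) (Aᵀ * A) = Aᵀ * A := cfc_id' ℝ _
  have hc (f : ℝ → ℝ) : ContinuousOn f (spectrum ℝ (Aᵀ * A)) := hfin.continuousOn f
  have hGS : cfc (fun t : ℝ => t⁻¹) (Aᵀ * A) * (Aᵀ * A)
      = cfc (fun t : ℝ => t⁻¹ * t) (Aᵀ * A) := by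
    rw [cfc_mul (fun t : ℝ => t⁻¹) (fun t : ℝ => t) _ (hc _) (hc _), hid]
  have hSG : (Aᵀ * A) * cfc (fun t : ℝ => t⁻¹) (Aᵀ * A)
      = cfc (fun t : ℝ => t * t⁻¹) (Aᵀ * A) := by
    rw [cfc_mul (fun t : ℝ => t) (fun t : ℝ => t⁻¹) _ (hc _) (hc _), hid]
  have hcomm : (Aᵀ * A) * cfc (fun t : ℝ => t⁻¹) (Aᵀ * A)
      = cfc (fun t : ℝ => t⁻¹) (Aᵀ * A) * (Aᵀ * A) := by
    rw [hSG, hGS]; simp only [mul_comm]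
  have hGSG : cfc (fun t : ℝ => t⁻¹) (Aᵀ * A) * (Aᵀ * A) * cfc (fun t : ℝ => t⁻¹) (Aᵀ * A)
      = cfc (fun t : ℝ => t⁻¹) (Aᵀ * A) := by
    rw [hGS, ← cfc_mul (fun t : ℝ => t⁻¹ * t) (fun t : ℝ => t⁻¹) _ (hc _) (hc _)]
    congr 1
    funext t
    by_cases ht : t = 0 <;> simp [ht]
  have hSGS : (Aᵀ * A) * cfc (fun t : ℝ => t⁻¹) (Aᵀ * A) * (Aᵀ * A) = Aᵀ * A := by
    have h := cfc_mul (fun t : ℝ => t * t⁻¹) (fun t : ℝ => t) (Aᵀ * A) (hc _) (hc _)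
    rw [hid, ← hSG] at h
    rw [← h]
    conv_rhs => rw [← hid]
    congr 1
    funext t
    by_cases ht : t = 0 <;> simp [ht]
  generalize cfc (fun t : ℝ => t⁻¹) (Aᵀ * A) = G at *
  have hAGS : A * (G * (Aᵀ * A)) = A := by
    rw [← sub_eq_zero, ← Matrix.conjTranspose_mul_self_eq_zero,
      Matrix.conjTranspose_eq_transpose_of_trivial, Matrix.transpose_sub, Matrix.transpose_mul,
      Matrix.transpose_mul, hSt, hGt]
    have e : (Aᵀ * A * G * Aᵀ - Aᵀ) * (A * (G * (Aᵀ * A)) - A)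
        = (Aᵀ * A * G * (Aᵀ * A) - Aᵀ * A) * (G * (Aᵀ * A)) -
          (Aᵀ * A * G * (Aᵀ * A) - Aᵀ * A) := by
      simp only [Matrix.sub_mul, Matrix.mul_sub, Matrix.mul_assoc]
    rw [e, hSGS]; simp
  refine ⟨?_, ?_, ?_, ?_⟩
  · rw [hdef]; simpa only [Matrix.mul_assoc] using hAGS
  · rw [hdef]
    calc G * Aᵀ * A * (G * Aᵀ) = (G * (Aᵀ * A) * G) * Aᵀ := by simp only [Matrix.mul_assoc]
      _ = G * Aᵀ := by rw [hGSG]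
  · rw [hdef]; simp only [Matrix.transpose_mul, Matrix.transpose_transpose, hGt, Matrix.mul_assoc]
  · rw [hdef, Matrix.mul_assoc, Matrix.transpose_mul, hSt, hGt, hcomm]

theorem IsMoorePenrose.eq_pinv {m n : ℕ} {A : Matrix (Fin m) (Fin n) ℝ}
    {B : Matrix (Fin n) (Fin m) ℝ} (h : IsMoorePenrose A B) : B = pinv A := by
  have k := isMoorePenrose_pinv A
  generalize pinv A = C at k
  have h1 : A * B = A * C := by
    calc A * B = (A * B)ᵀ := h.symm_left.symm
      _ = ((A * C) * (A * B))ᵀ := by rw [← Matrix.mul_assoc (A * C), k.mul_mul_left]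
      _ = (A * B) * (A * C) := by rw [Matrix.transpose_mul, h.symm_left, k.symm_left]
      _ = A * C := by rw [← Matrix.mul_assoc, h.mul_mul_left]
  have h2 : B * A = C * A := by
    calc B * A = (B * A)ᵀ := h.symm_right.symm
      _ = ((B * A) * (C * A))ᵀ := by
        rw [Matrix.mul_assoc B, ← Matrix.mul_assoc A, k.mul_mul_left]
      _ = (C * A) * (B * A) := by rw [Matrix.transpose_mul, h.symm_right, k.symm_right]
      _ = C * A := by rw [Matrix.mul_assoc C, ← Matrix.mul_assoc A, h.mul_mul_left]
  calc B = B * A * B := h.mul_mul_right.symm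
    _ = C * (A * B) := by rw [h2, Matrix.mul_assoc]
    _ = C := by rw [h1, ← Matrix.mul_assoc, k.mul_mul_right]

/-- The squared Frobenius norm. -/
def frobSq {m n : ℕ} (M : Matrix (Fin m) (Fin n) ℝ) : ℝ := ∑ i, ∑ j, M i j ^ 2

/-- The largest real eigenvalue of a square matrix. It is applied to positive semidefinite matrices
and to products of two such matrices, all of whose eigenvalues are real. -/
noncomputable def lambdaMax {n : ℕ} (M : Matrix (Fin n) (Fin n) ℝ) : ℝ := sSup (spectrum ℝ M)

/-- The `i`-th largest singular value `σ_i(M)`, with `i = 1` for the largest one, and `0` for `i`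
larger than the rank. -/
noncomputable def singularValue {m n : ℕ} (M : Matrix (Fin m) (Fin n) ℝ) (i : ℕ) : ℝ :=
  (Matrix.toEuclideanLin M).singularValues (i - 1)

/-- `B` is a top-`r` singular value truncation of `M`: in some singular value decomposition
`M = U diag(σ) Vᵀ` with `σ` in nonincreasing order, `B` keeps the first `r` singular values and
sets the others to zero. -/
def IsRankTruncation {m n : ℕ} (r : ℕ) (M B : Matrix (Fin m) (Fin n) ℝ) : Prop :=
  ∃ (U : Matrix (Fin m) (Fin (min m n)) ℝ) (V : Matrix (Fin n) (Fin (min m n)) ℝ)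
    (σ : Fin (min m n) → ℝ),
    Uᵀ * U = 1 ∧ Vᵀ * V = 1 ∧ Antitone σ ∧ (∀ i, 0 ≤ σ i) ∧
    M = U * Matrix.diagonal σ * Vᵀ ∧
    B = U * Matrix.diagonal (fun i : Fin (min m n) => if i.val < r then σ i else 0) * Vᵀ

/-- The matrix of the orthogonal projection of `ℝ^m` onto the orthogonal complement of the column
space of `X`. -/
noncomputable def projPerp {m n : ℕ} (X : Matrix (Fin m) (Fin n) ℝ) : Matrix (Fin m) (Fin m) ℝ :=
  Matrix.toEuclideanLin.symm
    ((LinearMap.range (Matrix.toEuclideanLin X))ᗮ.starProjection :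
      EuclideanSpace ℝ (Fin m) →ₗ[ℝ] EuclideanSpace ℝ (Fin m))

/-! ### The data model -/

/-- The law of a pair `(x, y)` with `x ∼ Px` and `y = A x + ε`, where `ε ∼ 𝒩(0, Sε)` is
independent of `x`. -/
noncomputable def dataLaw {dx dy : ℕ} (Px : Measure (EuclideanSpace ℝ (Fin dx)))
    (Sε : Matrix (Fin dy) (Fin dy) ℝ) (A : Matrix (Fin dy) (Fin dx) ℝ) :
    Measure (EuclideanSpace ℝ (Fin dx) × EuclideanSpace ℝ (Fin dy)) :=
  (Px.prod (multivariateGaussian 0 Sε)).map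
    (fun p => (p.1, Matrix.toEuclideanLin A p.1 + p.2))

/-- The population covariance `𝔼[x xᵀ]`. -/
noncomputable def popCov {dx : ℕ} (Px : Measure (EuclideanSpace ℝ (Fin dx))) :
    Matrix (Fin dx) (Fin dx) ℝ :=
  Matrix.of fun i j => ∫ x, x i * x j ∂Px

/-- The matrix whose columns are the vectors `v 0, …, v (n - 1)`. -/
def columns {d n : ℕ} (v : Fin n → EuclideanSpace ℝ (Fin d)) : Matrix (Fin d) (Fin n) ℝ :=
  Matrix.of fun j i => v i j

/-- The empirical covariance `(1/n) X Xᵀ`. -/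
noncomputable def empCov {dx n : ℕ} (X : Matrix (Fin dx) (Fin n) ℝ) :
    Matrix (Fin dx) (Fin dx) ℝ :=
  (n : ℝ)⁻¹ • (X * Xᵀ)

/-! ### Estimators and risk -/

/-- The full fine-tuning update `(Y - A₀ X) X†`. -/
noncomputable def fftUpdate {dx dy n : ℕ} (A₀ : Matrix (Fin dy) (Fin dx) ℝ)
    (X : Matrix (Fin dx) (Fin n) ℝ) (Y : Matrix (Fin dy) (Fin n) ℝ) :
    Matrix (Fin dy) (Fin dx) ℝ :=
  (Y - A₀ * X) * pinv X

/-- `A` is a rank-`r` LoRA solution `A₀ + [Δ_FFT Σ̂^{1/2}]_r (Σ̂^{1/2})†` for the data `X`, `Y`.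
If the truncation is unique, then so is `A`; otherwise every choice of it is allowed. -/
def IsLoRASolution {dx dy n : ℕ} (r : ℕ) (A₀ : Matrix (Fin dy) (Fin dx) ℝ)
    (X : Matrix (Fin dx) (Fin n) ℝ) (Y : Matrix (Fin dy) (Fin n) ℝ)
    (A : Matrix (Fin dy) (Fin dx) ℝ) : Prop :=
  ∃ T : Matrix (Fin dy) (Fin dx) ℝ,
    IsRankTruncation r (fftUpdate A₀ X Y * CFC.sqrt (empCov X)) T ∧
    A = A₀ + T * pinv (CFC.sqrt (empCov X))

/-- The population risk `R(A) = 𝔼 ‖A x - y‖²` over `(x, y) ∼ P`, as an element of `[0, ∞]`. -/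
noncomputable def risk {dx dy : ℕ}
    (P : Measure (EuclideanSpace ℝ (Fin dx) × EuclideanSpace ℝ (Fin dy)))
    (A : Matrix (Fin dy) (Fin dx) ℝ) : ℝ≥0∞ :=
  ∫⁻ p, ‖Matrix.toEuclideanLin A p.1 - p.2‖ₑ ^ 2 ∂P

end LoRA

/-! Noise and inputs are independent and the noise is centred, so the excess risk of any `A` is the
squared Frobenius norm of `(A - Astar) Σ^{1/2}` (`risk_le`). The theorem then rests on a
deterministic bound for this quantity and on a moment bound for the noise matrix `E = Y - Astar X`.

Deterministic part (`excess_le`). Let `S` be the square root of the empirical covariance and `P = X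
X† = S S†`. The truncated matrix is `M = Δ S + N` with `N = E X† S`, and `‖X† S‖² ≤ 1/n`. Let `K` be
`Δ` restricted to its top `r` right singular directions. Then `M - K S = (Δ - K) S + N` has squared
operator norm at most `2q`, where `q = σ_{r+1}² λmax(Σ̂) + ‖E‖²/n`. The truncation `T` is at least
as close to `M` in operator norm as the competitor `K S`, so `‖T - K S‖² ≤ 8q`; its rank is at most
`2r`, so its squared Frobenius norm is at most `16 r q`. Only here is the Frobenius norm reached,
which is why the noise costs `r ‖E‖²` and not `‖E‖_F²`. The error splits as `(A - Astar) Σ^{1/2} =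
-Δ P^⊥ Σ^{1/2} - (Δ - K) P Σ^{1/2} + (T - K S) S† Σ^{1/2}`. The first summand is the projection
term. The second is a Ky Fan estimate, since `P` has rank at most `n` (`exists_lowRank_approx`). The
third uses `‖S† Σ^{1/2}‖² = λmax(Σ Σ̂†)`.

Probabilistic part (`lintegral_opNorm_sq_le`). The second moment of `‖E‖` is at most `576 (n + dy)
λmax(Sε)`. A volume argument takes the place of a net: `exp(t ‖E‖ / 4)` is dominated by an average
of `exp(t ⟨v, E u⟩)` over two balls, at the price of a factor `5^(n + dy)`. Since `E` is independent
of `X`, this moment factors out of the noise term (`lintegral_mul_of_sample`). -/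

namespace LoRA

/-! ### Squared operator norm bounds and the Frobenius norm -/

/-- `c` bounds the square of the Euclidean operator norm of `M`. -/
def SqBound {m n : ℕ} (M : Matrix (Fin m) (Fin n) ℝ) (c : ℝ) : Prop :=
  ∀ v : Fin n → ℝ, (M *ᵥ v) ⬝ᵥ (M *ᵥ v) ≤ c * (v ⬝ᵥ v)

theorem zero_le_dotProduct_self {n : ℕ} (v : Fin n → ℝ) : 0 ≤ v ⬝ᵥ v :=
  Finset.sum_nonneg fun i _ => mul_self_nonneg (v i)

theorem sq_dotProduct_le {n : ℕ} (v w : Fin n → ℝ) :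
    (v ⬝ᵥ w) ^ 2 ≤ (v ⬝ᵥ v) * (w ⬝ᵥ w) := by
  have h := Finset.sum_mul_sq_le_sq_mul_sq Finset.univ v w
  simpa only [dotProduct, ← sq] using h

theorem mulVec_dotProduct {m n : ℕ} (M : Matrix (Fin m) (Fin n) ℝ) (v : Fin n → ℝ)
    (w : Fin m → ℝ) : (M *ᵥ v) ⬝ᵥ w = v ⬝ᵥ (Mᵀ *ᵥ w) := by
  rw [Matrix.mulVec_transpose, dotProduct_comm, Matrix.dotProduct_mulVec, dotProduct_comm]

namespace SqBound

variable {l m n : ℕ}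

theorem mono {M : Matrix (Fin m) (Fin n) ℝ} {c d : ℝ} (h : SqBound M c) (hcd : c ≤ d) :
    SqBound M d := fun v =>
  (h v).trans (mul_le_mul_of_nonneg_right hcd (zero_le_dotProduct_self v))

/-- For `w = Mᵀ v`, Cauchy–Schwarz applied to `|w|² = ⟨v, M w⟩` gives `|w|⁴ ≤ c |v|² |w|²`. The sign
of `c` matters only when `w = 0`. -/
theorem transpose {M : Matrix (Fin m) (Fin n) ℝ} {c : ℝ} (h : SqBound M c) (hc : 0 ≤ c) :
    SqBound Mᵀ c := by
  intro v
  have h1 : (Mᵀ *ᵥ v) ⬝ᵥ (Mᵀ *ᵥ v) = v ⬝ᵥ (M *ᵥ (Mᵀ *ᵥ v)) := by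
    rw [mulVec_dotProduct, Matrix.transpose_transpose]
  set w := Mᵀ *ᵥ v
  have h2 := sq_dotProduct_le v (M *ᵥ w)
  rw [← h1] at h2
  have h3 : (w ⬝ᵥ w) ^ 2 ≤ (c * (v ⬝ᵥ v)) * (w ⬝ᵥ w) := by
    have := mul_le_mul_of_nonneg_left (h w) (zero_le_dotProduct_self v)
    nlinarith
  rcases (zero_le_dotProduct_self w).eq_or_lt with h0 | h0
  · rw [← h0]; exact mul_nonneg hc (zero_le_dotProduct_self v)
  · rw [sq] at h3; exact le_of_mul_le_mul_right h3 h0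

theorem neg {M : Matrix (Fin m) (Fin n) ℝ} {c : ℝ} (h : SqBound M c) : SqBound (-M) c := by
  intro v
  simpa [Matrix.neg_mulVec] using h v

theorem mul {A : Matrix (Fin l) (Fin m) ℝ} {B : Matrix (Fin m) (Fin n) ℝ} {a b : ℝ}
    (hA : SqBound A a) (hB : SqBound B b) (ha : 0 ≤ a) : SqBound (A * B) (a * b) := by
  intro v
  rw [← Matrix.mulVec_mulVec, mul_assoc]
  exact (hA _).trans (mul_le_mul_of_nonneg_left (hB v) ha)

theorem add {A B : Matrix (Fin m) (Fin n) ℝ} {a b : ℝ} (hA : SqBound A a) (hB : SqBound B b) :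
    SqBound (A + B) (2 * (a + b)) := by
  intro v
  have h := zero_le_dotProduct_self (A *ᵥ v - B *ᵥ v)
  have h1 := hA v
  have h2 := hB v
  simp only [Matrix.add_mulVec, dotProduct_add, add_dotProduct, dotProduct_sub, sub_dotProduct]
    at h ⊢
  linarith

theorem of_transpose_mul_eq_one {U : Matrix (Fin m) (Fin n) ℝ} (h : Uᵀ * U = 1) :
    SqBound U 1 := by
  intro v
  rw [mulVec_dotProduct, Matrix.mulVec_mulVec, h, Matrix.one_mulVec, one_mul]

theorem diagonal {d : Fin n → ℝ} {c : ℝ} (h : ∀ i, d i ^ 2 ≤ c) :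
    SqBound (Matrix.diagonal d) c := by
  intro v
  simp only [dotProduct, Matrix.mulVec_diagonal, Finset.mul_sum]
  refine Finset.sum_le_sum fun i _ => ?_
  nlinarith [mul_le_mul_of_nonneg_right (h i) (mul_self_nonneg (v i))]

theorem of_isIdempotent {P : Matrix (Fin n) (Fin n) ℝ} (hs : Pᵀ = P) (hi : P * P = P) :
    SqBound P 1 := by
  intro v
  have h : (P *ᵥ v) ⬝ᵥ (P *ᵥ v) = v ⬝ᵥ (P *ᵥ v) := by
    rw [mulVec_dotProduct, hs, Matrix.mulVec_mulVec, hi]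
  have h2 := zero_le_dotProduct_self (v - P *ᵥ v)
  simp only [dotProduct_sub, sub_dotProduct, dotProduct_comm (P *ᵥ v) v] at h2
  linarith

end SqBound

section Frobenius

variable {l m n : ℕ}

theorem frobSq_nonneg (M : Matrix (Fin m) (Fin n) ℝ) : 0 ≤ frobSq M :=
  Finset.sum_nonneg fun _ _ => Finset.sum_nonneg fun _ _ => sq_nonneg _

theorem frobSq_transpose (M : Matrix (Fin m) (Fin n) ℝ) : frobSq Mᵀ = frobSq M := by
  simp only [frobSq, Matrix.transpose_apply]
  exact Finset.sum_comm

theorem frobSq_eq_trace (M : Matrix (Fin m) (Fin n) ℝ) : frobSq M = (Mᵀ * M).trace := by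
  rw [← frobSq_transpose]
  simp [frobSq, Matrix.trace, Matrix.mul_apply, sq]

theorem frobSq_mul_le_left {A : Matrix (Fin l) (Fin m) ℝ} {B : Matrix (Fin m) (Fin n) ℝ} {c : ℝ}
    (h : SqBound A c) : frobSq (A * B) ≤ c * frobSq B := by
  rw [← frobSq_transpose, ← frobSq_transpose B]
  simp only [frobSq, Finset.mul_sum]
  refine Finset.sum_le_sum fun j _ => ?_
  have := h (Bᵀ j)
  simp only [dotProduct, Finset.mul_sum, ← sq] at this
  exact this

theorem frobSq_mul_le_right {A : Matrix (Fin l) (Fin m) ℝ} {B : Matrix (Fin m) (Fin n) ℝ} {c : ℝ}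
    (h : SqBound B c) (hc : 0 ≤ c) : frobSq (A * B) ≤ c * frobSq A := by
  rw [← frobSq_transpose, ← frobSq_transpose A, Matrix.transpose_mul]
  exact frobSq_mul_le_left (h.transpose hc)

theorem frobSq_add_add_le (A B D : Matrix (Fin m) (Fin n) ℝ) :
    frobSq (A + B + D) ≤ 3 * (frobSq A + frobSq B + frobSq D) := by
  simp only [frobSq, Finset.mul_sum, ← Finset.sum_add_distrib, Matrix.add_apply]
  refine Finset.sum_le_sum fun i _ => Finset.sum_le_sum fun j _ => ?_
  nlinarith [sq_nonneg (A i j - B i j), sq_nonneg (A i j - D i j), sq_nonneg (B i j - D i j)]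

theorem frobSq_neg (A : Matrix (Fin m) (Fin n) ℝ) : frobSq (-A) = frobSq A := by
  simp [frobSq]

theorem eq_zero_of_mul_transpose_eq_zero {A : Matrix (Fin m) (Fin n) ℝ} (h : A * Aᵀ = 0) : A = 0 := by
  have := Matrix.self_mul_conjTranspose_eq_zero (A := A)
  rw [Matrix.conjTranspose_eq_transpose_of_trivial] at this
  exact this.mp h

end Frobenius

/-! ### Moore-Penrose projections -/

section Projection

variable {l m n : ℕ}

theorem pinv_transpose_of_symm {S : Matrix (Fin n) (Fin n) ℝ} (hS : Sᵀ = S) :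
    (pinv S)ᵀ = pinv S := by
  have h := isMoorePenrose_pinv S
  refine IsMoorePenrose.eq_pinv ⟨?_, ?_, ?_, ?_⟩
  · simpa [hS, Matrix.mul_assoc] using congrArg Matrix.transpose h.mul_mul_left
  · simpa [hS, Matrix.mul_assoc] using congrArg Matrix.transpose h.mul_mul_right
  · have := h.symm_right
    rw [Matrix.transpose_mul, hS] at this ⊢
    rw [this, Matrix.transpose_transpose]
  · have := h.symm_left
    rw [Matrix.transpose_mul, hS] at this ⊢
    rw [this, Matrix.transpose_transpose]

theorem mul_pinv_comm_of_symm {S : Matrix (Fin n) (Fin n) ℝ} (hS : Sᵀ = S) :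
    S * pinv S = pinv S * S := by
  have h := (isMoorePenrose_pinv S).symm_left
  rw [Matrix.transpose_mul, hS, pinv_transpose_of_symm hS] at h
  exact h.symm

/-- A symmetric `S` commutes with `S†`, so the Penrose equations for `S * S` collapse to those for
`S`. -/
theorem pinv_mul_self_of_symm {S : Matrix (Fin n) (Fin n) ℝ} (hS : Sᵀ = S) :
    pinv S * pinv S = pinv (S * S) := by
  have h := isMoorePenrose_pinv S
  have hc := mul_pinv_comm_of_symm hS
  have e1 : S * S * (pinv S * pinv S) = S * pinv S := by
    calc S * S * (pinv S * pinv S) = S * (S * pinv S) * pinv S := by simp only [Matrix.mul_assoc]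
      _ = S * (pinv S * S) * pinv S := congrArg (fun Z => S * Z * pinv S) hc
      _ = (S * pinv S * S) * pinv S := by simp only [Matrix.mul_assoc]
      _ = _ := by rw [h.mul_mul_left]
  have e2 : pinv S * pinv S * (S * S) = pinv S * S := by
    calc pinv S * pinv S * (S * S) = pinv S * (pinv S * S) * S := by simp only [Matrix.mul_assoc]
      _ = pinv S * (S * pinv S) * S := congrArg (fun Z => pinv S * Z * S) hc.symm
      _ = (pinv S * S * pinv S) * S := by simp only [Matrix.mul_assoc]
      _ = _ := by rw [h.mul_mul_right]
  refine IsMoorePenrose.eq_pinv ⟨?_, ?_, ?_, ?_⟩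
  · rw [e1, ← Matrix.mul_assoc, h.mul_mul_left]
  · rw [e2, ← Matrix.mul_assoc, h.mul_mul_right]
  · rw [e1, h.symm_left]
  · rw [e2, h.symm_right]

/-- Two matrices with the same Gram matrix of rows, up to a factor, have the same range
projection. -/
theorem mul_pinv_eq_of_mul_transpose_eq {A : Matrix (Fin l) (Fin m) ℝ}
    {B : Matrix (Fin l) (Fin n) ℝ} {c : ℝ} (hc : c ≠ 0) (h : A * Aᵀ = c • (B * Bᵀ)) :
    A * pinv A = B * pinv B := by
  -- `B B†` fixes `B Bᵀ`, hence `A Aᵀ`, so the row Gram matrix of `B B† A - A` vanishes. Used in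
  -- both directions, this makes each projection absorb the other.
  have key : ∀ {m n : ℕ} {A : Matrix (Fin l) (Fin m) ℝ} {B : Matrix (Fin l) (Fin n) ℝ} {c : ℝ},
      A * Aᵀ = c • (B * Bᵀ) → B * pinv B * A = A := by
    intro m n A B c h
    have hB := isMoorePenrose_pinv B
    rw [← sub_eq_zero]
    apply eq_zero_of_mul_transpose_eq_zero
    have e : (B * pinv B * A - A) * (B * pinv B * A - A)ᵀ
        = (B * pinv B * (A * Aᵀ) - A * Aᵀ) * (B * pinv B)ᵀ - (B * pinv B * (A * Aᵀ) - A * Aᵀ) := by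
      simp only [Matrix.transpose_sub, Matrix.transpose_mul, Matrix.sub_mul, Matrix.mul_sub,
        Matrix.mul_assoc]
    have e2 : B * pinv B * (A * Aᵀ) - A * Aᵀ = 0 := by
      rw [h, Matrix.mul_smul, ← Matrix.mul_assoc, hB.mul_mul_left, sub_self]
    rw [e, e2]; simp
  have h1 := key h
  have h2 : A * pinv A * B = B := key (c := c⁻¹) (by rw [h, smul_smul, inv_mul_cancel₀ hc, one_smul])
  have hA := isMoorePenrose_pinv A
  have hB := isMoorePenrose_pinv B
  calc A * pinv A = (B * pinv B * A) * pinv A := by rw [h1]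
    _ = ((A * pinv A) * (B * pinv B))ᵀ := by
      rw [Matrix.transpose_mul, hA.symm_left, hB.symm_left, Matrix.mul_assoc (B * pinv B)]
    _ = (B * pinv B)ᵀ := by rw [← Matrix.mul_assoc, h2]
    _ = _ := hB.symm_left

theorem mul_pinv_idem (A : Matrix (Fin m) (Fin n) ℝ) :
    A * pinv A * (A * pinv A) = A * pinv A := by
  rw [← Matrix.mul_assoc, (isMoorePenrose_pinv A).mul_mul_left]

theorem trace_eq_rank_of_idem {Q : Matrix (Fin n) (Fin n) ℝ} (hQ : Q * Q = Q) :
    Q.trace = Q.rank := by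
  have hp : LinearMap.IsProj (LinearMap.range Q.mulVecLin) Q.mulVecLin := by
    refine ⟨fun x => LinearMap.mem_range_self _ x, ?_⟩
    rintro _ ⟨y, rfl⟩
    simp [Matrix.mulVec_mulVec, hQ]
  have := hp.trace
  exact (Matrix.trace_toLin'_eq Q).symm.trans this

theorem trace_mul_pinv_le (A : Matrix (Fin m) (Fin n) ℝ) : (A * pinv A).trace ≤ A.rank := by
  rw [trace_eq_rank_of_idem (mul_pinv_idem A)]
  exact Nat.cast_le.mpr (Matrix.rank_mul_le_left A (pinv A))

/-- Write `M = (M M†) M`: the squared Frobenius norm of the projection `M M†` is its trace, which is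
at most the rank of `M`. -/
theorem frobSq_le_rank_mul {M : Matrix (Fin m) (Fin n) ℝ} {c : ℝ} (h : SqBound M c)
    (hc : 0 ≤ c) : frobSq M ≤ c * M.rank := by
  have hM := isMoorePenrose_pinv M
  have h1 : M = M * pinv M * M := hM.mul_mul_left.symm
  calc frobSq M = frobSq (M * pinv M * M) := by rw [← h1]
    _ ≤ c * frobSq (M * pinv M) := frobSq_mul_le_right h hc
    _ ≤ c * M.rank := by
      rw [frobSq_eq_trace, hM.symm_left, mul_pinv_idem]
      exact mul_le_mul_of_nonneg_left (trace_mul_pinv_le M) hc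

end Projection

/-! ### Truncations -/

section Truncation

variable {m n : ℕ}

theorem exists_mulVec_eq_zero_of_rank_lt {k : ℕ} {A : Matrix (Fin m) (Fin n) ℝ}
    {D : Matrix (Fin k) (Fin n) ℝ} (h : A.rank < D.rank) :
    ∃ v, A *ᵥ v = 0 ∧ D *ᵥ v ≠ 0 := by
  by_contra! hcon
  have h1 : LinearMap.ker A.mulVecLin ≤ LinearMap.ker D.mulVecLin := fun v hv => by
    simpa using hcon v (by simpa using hv)
  have h2 := Submodule.finrank_mono h1
  have h3 := LinearMap.finrank_range_add_finrank_ker A.mulVecLin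
  have h4 := LinearMap.finrank_range_add_finrank_ker D.mulVecLin
  unfold Matrix.rank at h
  omega

theorem IsRankTruncation.rank_le {r : ℕ} {M B : Matrix (Fin m) (Fin n) ℝ}
    (h : IsRankTruncation r M B) : B.rank ≤ r := by
  obtain ⟨U, V, σ, -, -, -, -, -, rfl⟩ := h
  refine (Matrix.rank_mul_le_left _ _).trans ((Matrix.rank_mul_le_right _ _).trans ?_)
  rw [Matrix.rank_diagonal, Fintype.card_subtype]
  calc _ ≤ (Finset.univ.filter fun i : Fin (min m n) => i.val < r).card := by
        refine Finset.card_le_card fun i hi => ?_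
        by_contra hr
        simp_all
    _ ≤ (Finset.range r).card := by
        refine Finset.card_le_card_of_injOn (fun i => i.val) (fun i hi => ?_)
          (fun i _ j _ hij => Fin.ext hij)
        simpa using hi
    _ = r := by simp

/-- A truncated singular value decomposition is a best low-rank approximation in operator norm. -/
theorem IsRankTruncation.sqBound_sub {r : ℕ} {M B K : Matrix (Fin m) (Fin n) ℝ}
    (h : IsRankTruncation r M B) (hK : K.rank ≤ r) {c : ℝ} (hc : 0 ≤ c)
    (hb : SqBound (M - K) c) : SqBound (M - B) c := by
  obtain ⟨U, V, σ, hU, hV, hσ, hσ0, rfl, rfl⟩ := h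
  -- The first `i + 1 > r` right singular vectors span a space too large for `K` to be injective on
  -- it. A nonzero vector there killed by `K` is stretched by `M - K = M` by a factor of at least `σ
  -- i`.
  have hτ : ∀ i : Fin (min m n), r ≤ i.val → σ i ^ 2 ≤ c := by
    intro i hi
    let D : Matrix (Fin (min m n)) (Fin (min m n)) ℝ :=
      Matrix.diagonal fun j => if j ≤ i then 1 else 0
    have hD : D.rank = i.val + 1 := by
      rw [Matrix.rank_diagonal, Fintype.card_subtype]
      have : (Finset.univ.filter fun j : Fin (min m n) => (if j ≤ i then (1 : ℝ) else 0) ≠ 0)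
          = Finset.Iic i := by ext j; simp
      rw [this, Fin.card_Iic]
    obtain ⟨v, hv0, hv1⟩ := exists_mulVec_eq_zero_of_rank_lt (A := K * (V * D)) (D := D)
      (by rw [hD]; exact Nat.lt_succ_of_le (((Matrix.rank_mul_le_left _ _).trans hK).trans hi))
    obtain ⟨b, hbdef⟩ : ∃ b, b = D *ᵥ v := ⟨_, rfl⟩
    rw [← hbdef] at hv1
    have hKb : K *ᵥ (V *ᵥ b) = 0 := by
      rw [hbdef, Matrix.mulVec_mulVec, Matrix.mulVec_mulVec, Matrix.mul_assoc, hv0]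
    have hbi : ∀ j, ¬ j ≤ i → b j = 0 := by
      intro j hj
      simp [hbdef, D, Matrix.mulVec_diagonal, hj]
    have hVb : (V *ᵥ b) ⬝ᵥ (V *ᵥ b) = b ⬝ᵥ b := by
      rw [mulVec_dotProduct, Matrix.mulVec_mulVec, hV, Matrix.one_mulVec]
    have hMb : ((U * Matrix.diagonal σ * Vᵀ - K) *ᵥ (V *ᵥ b))
        = U *ᵥ (Matrix.diagonal σ *ᵥ b) := by
      rw [Matrix.sub_mulVec, hKb, sub_zero, Matrix.mulVec_mulVec, Matrix.mul_assoc, hV,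
        Matrix.mul_one, Matrix.mulVec_mulVec]
    have h1 := hb (V *ᵥ b)
    rw [hMb, hVb, mulVec_dotProduct U, Matrix.mulVec_mulVec _ Uᵀ, hU, Matrix.one_mulVec] at h1
    have h2 : σ i ^ 2 * (b ⬝ᵥ b) ≤ (Matrix.diagonal σ *ᵥ b) ⬝ᵥ (Matrix.diagonal σ *ᵥ b) := by
      simp only [dotProduct, Matrix.mulVec_diagonal, Finset.mul_sum]
      refine Finset.sum_le_sum fun j _ => ?_
      by_cases hj : j ≤ i
      · have : σ i ^ 2 ≤ σ j ^ 2 := pow_le_pow_left₀ (hσ0 i) (hσ hj) 2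
        nlinarith [mul_le_mul_of_nonneg_right this (mul_self_nonneg (b j))]
      · simp [hbi j hj]
    have hbpos : 0 < b ⬝ᵥ b := by
      refine lt_of_le_of_ne (zero_le_dotProduct_self b) fun h0 => hv1 ?_
      exact dotProduct_self_eq_zero.mp h0.symm
    exact le_of_mul_le_mul_right (h2.trans h1) hbpos
  have e : U * Matrix.diagonal σ * Vᵀ
      - U * Matrix.diagonal (fun i : Fin (min m n) => if i.val < r then σ i else 0) * Vᵀ
      = U * Matrix.diagonal (fun i : Fin (min m n) => if i.val < r then 0 else σ i) * Vᵀ := by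
    rw [← Matrix.sub_mul, ← Matrix.mul_sub, Matrix.diagonal_sub]
    congr 3
    funext i
    split_ifs <;> simp
  rw [e]
  have hd : SqBound (Matrix.diagonal
      (fun i : Fin (min m n) => if i.val < r then 0 else σ i)) c := by
    refine SqBound.diagonal fun i => ?_
    split_ifs with hi
    · simpa using hc
    · exact hτ i (not_lt.mp hi)
  have := (((SqBound.of_transpose_mul_eq_one hU).mul hd zero_le_one).mul
    ((SqBound.of_transpose_mul_eq_one hV).transpose zero_le_one) (by simpa using hc))
  simpa using this

end Truncation

/-! ### Singular values -/

section SingularValues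

variable {m n : ℕ}

theorem singularValue_sq_antitone (A : Matrix (Fin m) (Fin n) ℝ) :
    Antitone fun i => singularValue A (i + 1) ^ 2 := fun i j hij =>
  pow_le_pow_left₀ (LinearMap.singularValues_nonneg _ _)
    (LinearMap.singularValues_antitone (Matrix.toEuclideanLin A) (by omega)) 2

theorem singularValue_eq_zero (A : Matrix (Fin m) (Fin n) ℝ) {i : ℕ} (hi : m ≤ i) :
    singularValue A (i + 1) = 0 := by
  unfold singularValue
  rw [LinearMap.singularValues_eq_zero_iff_le_finrank_range]
  refine (Submodule.finrank_le _).trans ?_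
  simpa using hi

/-- The Gram matrix `AᵀA` is orthogonally diagonalized with the squared singular values of `A` on
the diagonal. -/
theorem exists_orthogonal_diagonalization (A : Matrix (Fin m) (Fin n) ℝ) :
    ∃ V : Matrix (Fin n) (Fin n) ℝ, Vᵀ * V = 1 ∧ V * Vᵀ = 1 ∧
      Vᵀ * (Aᵀ * A) * V = Matrix.diagonal fun i : Fin n => singularValue A (i + 1) ^ 2 := by
  have hn : Module.finrank ℝ (EuclideanSpace ℝ (Fin n)) = n := by simp
  set T := Matrix.toEuclideanLin A
  have hT := T.isSymmetric_adjoint_comp_self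
  obtain ⟨b, hb⟩ : ∃ b : OrthonormalBasis (Fin n) ℝ (EuclideanSpace ℝ (Fin n)),
      ∀ j, LinearMap.adjoint T (T (b j)) = (T.singularValues j ^ 2) • b j := by
    refine ⟨hT.eigenvectorBasis hn, fun j => ?_⟩
    rw [T.sq_singularValues_fin hn j]
    exact hT.apply_eigenvectorBasis hn j
  let V : Matrix (Fin n) (Fin n) ℝ := Matrix.of fun i j => b j i
  have hV : Vᵀ * V = 1 := by
    ext i j
    have := b.inner_eq_ite i j
    simp only [PiLp.inner_apply, RCLike.inner_apply, conj_trivial] at this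
    rw [Matrix.one_apply, Matrix.mul_apply, ← this]
    exact Finset.sum_congr rfl fun k _ => mul_comm _ _
  refine ⟨V, hV, mul_eq_one_comm.mp hV, ?_⟩
  have hTV : (Aᵀ * A) * V = V * Matrix.diagonal fun i : Fin n => singularValue A (i + 1) ^ 2 := by
    ext i j
    have h1 := hb j
    have h2 : LinearMap.adjoint T = Matrix.toEuclideanLin Aᵀ := by
      rw [← Matrix.conjTranspose_eq_transpose_of_trivial,
        Matrix.toEuclideanLin_conjTranspose_eq_adjoint]
    rw [h2] at h1
    have h3 := congrArg (fun z : EuclideanSpace ℝ (Fin n) => z i) h1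
    simp only [T, Matrix.toLpLin_apply, Matrix.mulVec_mulVec] at h3
    rw [Matrix.mul_diagonal, Matrix.mul_apply]
    simp only [Matrix.mulVec, dotProduct, PiLp.smul_apply, smul_eq_mul] at h3
    rw [mul_comm]
    exact h3
  rw [Matrix.mul_assoc, hTV, ← Matrix.mul_assoc, hV, Matrix.one_mul]

/-- The Ky Fan type estimate behind the tail bound of a truncation. -/
theorem sum_mul_le_of_antitone {s : ℕ → ℝ} (hs : Antitone s) (hs0 : ∀ i, 0 ≤ s i) {r k d : ℕ}
    (hrk : r ≤ k) {p : Fin d → ℝ} (hp0 : ∀ i, 0 ≤ p i) (hp1 : ∀ i, p i ≤ 1)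
    (hp : ∑ i, p i ≤ k) :
    ∑ i : Fin d, (if i.val < r then 0 else s i) * p i
      ≤ ∑ i ∈ Finset.Ico r k, s i + r * s k := by
  -- Charge `s k` for every unit of weight, and the surplus `s i - s k` only on `[r, k)`, where `p i
  -- ≤ 1`. The total charge `k * s k` restores the `k - r` subtracted copies of `s k` and leaves `r
  -- * s k`.
  have h1 : ∀ i : Fin d, (if i.val < r then 0 else s i) * p i
      ≤ (if i.val ∈ Finset.Ico r k then s i - s k else 0) + s k * p i := by
    intro i
    have hk := mul_nonneg (hs0 k) (hp0 i)
    by_cases h : i.val < r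
    · have : i.val ∉ Finset.Ico r k := by simp; omega
      simpa [h, this] using hk
    · by_cases h2 : i.val < k
      · have h3 : i.val ∈ Finset.Ico r k := by simp; omega
        have h4 : s k ≤ s i := hs h2.le
        simp only [h, h3, if_true, if_false]
        nlinarith [mul_le_mul_of_nonneg_left (hp1 i) (sub_nonneg.2 h4)]
      · have h3 : i.val ∉ Finset.Ico r k := by simp; omega
        have h4 : s i ≤ s k := hs (not_lt.mp h2)
        simp only [h, h3, if_false, zero_add]
        exact mul_le_mul_of_nonneg_right h4 (hp0 i)
  have h2 : ∑ i : Fin d, (if i.val ∈ Finset.Ico r k then s i - s k else 0)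
      ≤ ∑ i ∈ Finset.Ico r k, (s i - s k) := by
    rw [← Finset.sum_filter, ← Finset.sum_image (f := fun i : ℕ => s i - s k)
      (fun i _ j _ hij => Fin.ext hij)]
    refine Finset.sum_le_sum_of_subset_of_nonneg ?_ ?_
    · intro j hj
      simp only [Finset.mem_image, Finset.mem_filter] at hj
      obtain ⟨i, hi, rfl⟩ := hj
      exact hi.2
    · intro j hj _
      exact sub_nonneg.2 (hs (Finset.mem_Ico.mp hj).2.le)
  calc _ ≤ _ := Finset.sum_le_sum fun i _ => h1 i
    _ = ∑ i : Fin d, (if i.val ∈ Finset.Ico r k then s i - s k else 0) + s k * ∑ i, p i := by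
      rw [Finset.sum_add_distrib, Finset.mul_sum]
    _ ≤ ∑ i ∈ Finset.Ico r k, (s i - s k) + s k * k :=
      add_le_add h2 (mul_le_mul_of_nonneg_left hp (hs0 k))
    _ = _ := by
      rw [Finset.sum_sub_distrib, Finset.sum_const, Nat.card_Ico, nsmul_eq_mul, Nat.cast_sub hrk]
      ring

/-- A rank-`r` approximation whose error is controlled by the remaining singular values, also after
multiplication by a projection of rank at most `k`. -/
theorem exists_lowRank_approx (A : Matrix (Fin m) (Fin n) ℝ) {r k : ℕ} (hrk : r ≤ k) :
    ∃ K : Matrix (Fin m) (Fin n) ℝ, K.rank ≤ r ∧ SqBound (A - K) (singularValue A (r + 1) ^ 2) ∧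
      ∀ P : Matrix (Fin n) (Fin n) ℝ, Pᵀ = P → P * P = P → P.trace ≤ k →
        frobSq ((A - K) * P) ≤ r * singularValue A (r + 1) ^ 2
          + ∑ i ∈ Finset.Icc (r + 1) (min k m), singularValue A i ^ 2 := by
  obtain ⟨V, hV, hV', hA⟩ := exists_orthogonal_diagonalization A
  set s : ℕ → ℝ := fun i => singularValue A (i + 1) ^ 2 with hs
  have hsa : Antitone s := singularValue_sq_antitone A
  have hs0 : ∀ i, 0 ≤ s i := fun i => sq_nonneg _
  let D : Matrix (Fin n) (Fin n) ℝ := Matrix.diagonal fun i => if i.val < r then 1 else 0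
  let D' : Matrix (Fin n) (Fin n) ℝ := Matrix.diagonal fun i => if i.val < r then 0 else 1
  have hDD : D + D' = 1 := by
    rw [Matrix.diagonal_add, ← Matrix.diagonal_one]
    congr 1
    funext i
    split_ifs <;> simp
  have hAK : A - A * (V * D * Vᵀ) = A * V * D' * Vᵀ := by
    have : V * D * Vᵀ + V * D' * Vᵀ = 1 := by
      rw [← Matrix.add_mul, ← Matrix.mul_add, hDD, Matrix.mul_one, hV']
    calc A - A * (V * D * Vᵀ) = A * (V * D * Vᵀ + V * D' * Vᵀ) - A * (V * D * Vᵀ) := by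
          rw [this, Matrix.mul_one]
      _ = _ := by rw [Matrix.mul_add, add_sub_cancel_left]; simp only [Matrix.mul_assoc]
  have hgram : (A * V * D')ᵀ * (A * V * D')
      = Matrix.diagonal fun i : Fin n => if i.val < r then 0 else s i := by
    have : (A * V * D')ᵀ * (A * V * D') = D' * (Vᵀ * (Aᵀ * A) * V) * D' := by
      simp only [Matrix.transpose_mul, Matrix.mul_assoc, D', Matrix.diagonal_transpose]
    rw [this, hA, Matrix.diagonal_mul_diagonal, Matrix.diagonal_mul_diagonal]
    congr 1
    funext i
    split_ifs <;> simp [hs]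
  refine ⟨A * (V * D * Vᵀ), ?_, ?_, ?_⟩
  · refine (Matrix.rank_mul_le_right _ _).trans ((Matrix.rank_mul_le_left _ _).trans
      ((Matrix.rank_mul_le_right _ _).trans ?_))
    rw [Matrix.rank_diagonal, Fintype.card_subtype]
    calc _ ≤ (Finset.range r).card := by
          refine Finset.card_le_card_of_injOn (fun i => i.val) (fun i hi => ?_)
            (fun i _ j _ hij => Fin.ext hij)
          simpa using hi
      _ = r := by simp
  · rw [hAK]
    have h1 : SqBound (A * V * D') (s r) := by
      intro v
      rw [mulVec_dotProduct, Matrix.mulVec_mulVec, hgram]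
      simp only [dotProduct, Matrix.mulVec_diagonal, Finset.mul_sum]
      refine Finset.sum_le_sum fun i _ => ?_
      split_ifs with h
      · simpa using mul_nonneg (hs0 r) (mul_self_nonneg (v i))
      · nlinarith [mul_le_mul_of_nonneg_right (hsa (not_lt.mp h)) (mul_self_nonneg (v i))]
    simpa using h1.mul ((SqBound.of_transpose_mul_eq_one hV).transpose zero_le_one) (hs0 r)
  · intro P hPt hPP hPk
    have hPb := SqBound.of_isIdempotent hPt hPP
    -- The diagonal entries of `Vᵀ P V` are the Ky Fan weights: they lie in `[0, 1]` and sum to the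
    -- trace of `P`.
    have hp : ∀ i, (Vᵀ * P * V) i i = (P *ᵥ (Vᵀ i)) ⬝ᵥ (P *ᵥ (Vᵀ i)) := by
      intro i
      rw [mulVec_dotProduct, hPt, Matrix.mulVec_mulVec, hPP, Matrix.mul_assoc, Matrix.mul_apply]
      rfl
    have h1 : frobSq ((A - A * (V * D * Vᵀ)) * P)
        = ∑ i : Fin n, (if i.val < r then 0 else s i) * (Vᵀ * P * V) i i := by
      rw [hAK, frobSq_eq_trace]
      have e : (A * V * D' * Vᵀ * P)ᵀ * (A * V * D' * Vᵀ * P)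
          = (P * V) * ((A * V * D')ᵀ * (A * V * D') * Vᵀ * P) := by
        rw [Matrix.transpose_mul _ P, Matrix.transpose_mul _ Vᵀ, hPt, Matrix.transpose_transpose]
        simp only [Matrix.mul_assoc]
      rw [e, Matrix.trace_mul_comm, hgram]
      have e2 : (Matrix.diagonal fun i : Fin n => if i.val < r then 0 else s i) * Vᵀ * P * (P * V)
          = (Matrix.diagonal fun i : Fin n => if i.val < r then 0 else s i) * (Vᵀ * P * V) := by
        calc _ = (Matrix.diagonal fun i : Fin n => if i.val < r then 0 else s i)
                * (Vᵀ * (P * P) * V) := by simp only [Matrix.mul_assoc]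
          _ = _ := by rw [hPP]
      rw [e2, Matrix.trace]
      simp only [Matrix.diag_apply, Matrix.diagonal_mul]
    have h2 : ∑ i, (Vᵀ * P * V) i i ≤ k := by
      have : ∑ i, (Vᵀ * P * V) i i = P.trace := by
        change (Vᵀ * P * V).trace = _
        rw [Matrix.mul_assoc, Matrix.trace_mul_comm, Matrix.mul_assoc, hV', Matrix.mul_one]
      rwa [this]
    have h3 : ∀ i, (Vᵀ * P * V) i i ≤ 1 := by
      intro i
      rw [hp]
      refine (hPb _).trans ?_
      have : (Vᵀ * V) i i = 1 := by rw [hV, Matrix.one_apply_eq]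
      rw [Matrix.mul_apply] at this
      rw [one_mul]
      exact this.le
    have h4 := sum_mul_le_of_antitone hsa hs0 hrk
      (fun i => by rw [hp]; exact zero_le_dotProduct_self _) h3 h2
    rw [h1]
    refine h4.trans ?_
    rw [add_comm]
    refine add_le_add (mul_le_mul_of_nonneg_left (hsa hrk) (Nat.cast_nonneg r)) ?_
    -- There are at most `m` nonzero singular values, which caps the sum at `min k m`; the shift by
    -- one then passes to indices starting at `1`.
    have h5 : ∑ i ∈ Finset.Ico r k, s i = ∑ i ∈ Finset.Ico r (min k m), s i := by
      refine (Finset.sum_subset (Finset.Ico_subset_Ico_right (min_le_left _ _)) ?_).symm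
      intro i hi hi'
      have : m ≤ i := by simp only [Finset.mem_Ico] at hi hi'; omega
      simp [hs, singularValue_eq_zero A this]
    rw [h5, Finset.sum_Ico_add' (fun i => singularValue A i ^ 2) r (min k m) 1]
    rfl

end SingularValues

/-! ### Largest eigenvalues and square roots -/

section Eigenvalues

variable {m n : ℕ}

theorem bddAbove_spectrum (A : Matrix (Fin n) (Fin n) ℝ) : BddAbove (spectrum ℝ A) :=
  Matrix.finite_real_spectrum.bddAbove

theorem dotProduct_mulVec_le_of_spectrum_le {A : Matrix (Fin n) (Fin n) ℝ} (hA : A.IsHermitian)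
    {c : ℝ} (h : ∀ t ∈ spectrum ℝ A, t ≤ c) (v : Fin n → ℝ) : v ⬝ᵥ (A *ᵥ v) ≤ c * (v ⬝ᵥ v) := by
  have hp : (algebraMap ℝ (Matrix (Fin n) (Fin n) ℝ) c - A).PosSemidef := by
    rw [Matrix.posSemidef_iff_isHermitian_and_spectrum_nonneg]
    refine ⟨?_, ?_⟩
    · refine Matrix.IsHermitian.sub ?_ hA
      rw [Matrix.algebraMap_eq_diagonal]
      exact Matrix.isHermitian_diagonal _
    · intro t ht
      rw [← spectrum.singleton_sub_eq, Set.singleton_sub] at ht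
      obtain ⟨u, hu, rfl⟩ := ht
      exact sub_nonneg.2 (h u hu)
  have := hp.dotProduct_mulVec_nonneg v
  rw [Matrix.sub_mulVec, dotProduct_sub, Algebra.algebraMap_eq_smul_one, Matrix.smul_mulVec,
    Matrix.one_mulVec, dotProduct_smul, star_trivial, smul_eq_mul] at this
  linarith

theorem dotProduct_mulVec_le_lambdaMax {A : Matrix (Fin n) (Fin n) ℝ} (hA : A.IsHermitian)
    (v : Fin n → ℝ) : v ⬝ᵥ (A *ᵥ v) ≤ lambdaMax A * (v ⬝ᵥ v) :=
  dotProduct_mulVec_le_of_spectrum_le hA (fun _ ht => le_csSup (bddAbove_spectrum A) ht) v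

theorem exists_mulVec_eq_of_mem_spectrum {A : Matrix (Fin n) (Fin n) ℝ} {t : ℝ}
    (ht : t ∈ spectrum ℝ A) : ∃ v, v ≠ 0 ∧ A *ᵥ v = t • v := by
  rw [spectrum.mem_iff, Matrix.isUnit_iff_isUnit_det, isUnit_iff_ne_zero, not_not] at ht
  obtain ⟨v, hv, h⟩ := Matrix.exists_mulVec_eq_zero_iff.mpr ht
  refine ⟨v, hv, ?_⟩
  rw [Matrix.sub_mulVec, Algebra.algebraMap_eq_smul_one, Matrix.smul_mulVec, Matrix.one_mulVec,
    sub_eq_zero] at h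
  exact h.symm

theorem le_of_mem_spectrum {A : Matrix (Fin n) (Fin n) ℝ} {c : ℝ}
    (h : ∀ v : Fin n → ℝ, v ⬝ᵥ (A *ᵥ v) ≤ c * (v ⬝ᵥ v)) {t : ℝ} (ht : t ∈ spectrum ℝ A) :
    t ≤ c := by
  obtain ⟨v, hv, hAv⟩ := exists_mulVec_eq_of_mem_spectrum ht
  have h1 := h v
  rw [hAv, dotProduct_smul, smul_eq_mul] at h1
  have hpos : 0 < v ⬝ᵥ v := lt_of_le_of_ne (zero_le_dotProduct_self v)
    fun h0 => hv (dotProduct_self_eq_zero.mp h0.symm)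
  exact le_of_mul_le_mul_right h1 hpos

theorem nonneg_of_mem_spectrum {A : Matrix (Fin n) (Fin n) ℝ} (hA : A.PosSemidef) {t : ℝ}
    (ht : t ∈ spectrum ℝ A) : 0 ≤ t :=
  (Matrix.posSemidef_iff_isHermitian_and_spectrum_nonneg.mp hA).2 ht

/-- An eigenvector `v` of `A B` yields the eigenvector `B v` of `B A`, nonzero because `t ≠ 0`. -/
theorem mem_spectrum_mul_comm {A B : Matrix (Fin n) (Fin n) ℝ} {t : ℝ} (ht : t ≠ 0)
    (h : t ∈ spectrum ℝ (A * B)) : t ∈ spectrum ℝ (B * A) := by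
  obtain ⟨v, hv, hABv⟩ := exists_mulVec_eq_of_mem_spectrum h
  rw [spectrum.mem_iff, Matrix.isUnit_iff_isUnit_det, isUnit_iff_ne_zero, not_not]
  refine Matrix.exists_mulVec_eq_zero_iff.mp ⟨B *ᵥ v, fun h0 => ?_, ?_⟩
  · rw [← Matrix.mulVec_mulVec, h0, Matrix.mulVec_zero] at hABv
    exact (smul_ne_zero ht hv) hABv.symm
  · rw [Matrix.sub_mulVec, Algebra.algebraMap_eq_smul_one, Matrix.smul_mulVec, Matrix.one_mulVec,
      sub_eq_zero, Matrix.mulVec_mulVec, Matrix.mul_assoc, ← Matrix.mulVec_mulVec, hABv,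
      Matrix.mulVec_smul]

theorem lambdaMax_nonneg {A : Matrix (Fin n) (Fin n) ℝ} (hA : A.PosSemidef) : 0 ≤ lambdaMax A :=
  Real.sSup_nonneg fun _ ht => nonneg_of_mem_spectrum hA ht

section Product

variable {R G : Matrix (Fin n) (Fin n) ℝ}

theorem posSemidef_conj (hR : Rᵀ = R) (hG : G.PosSemidef) : (R * G * R).PosSemidef := by
  have := hG.conjTranspose_mul_mul_same R
  rwa [Matrix.conjTranspose_eq_transpose_of_trivial, hR] at this

theorem lambdaMax_mul_nonneg (hR : Rᵀ = R) (hG : G.PosSemidef) : 0 ≤ lambdaMax (R * R * G) := by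
  refine Real.sSup_nonneg fun t ht => ?_
  by_cases h0 : t = 0
  · exact h0.ge
  · rw [Matrix.mul_assoc] at ht
    exact nonneg_of_mem_spectrum (posSemidef_conj hR hG) (mem_spectrum_mul_comm h0 ht)

/-- `R R G` is not symmetric, but it shares its nonzero eigenvalues with the positive semidefinite
`R G R`, to which the Rayleigh quotient applies. The clause `0 ≤ c` is needed in dimension zero,
where the supremum of the empty spectrum is `0`. The right side also exhibits sublevel sets as
closed conditions on `G`, which gives measurability. -/
theorem lambdaMax_mul_le_iff (hR : Rᵀ = R) (hG : G.PosSemidef) {c : ℝ} :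
    lambdaMax (R * R * G) ≤ c ↔
      0 ≤ c ∧ ∀ v : Fin n → ℝ, v ⬝ᵥ ((R * G * R) *ᵥ v) ≤ c * (v ⬝ᵥ v) := by
  constructor
  · intro h
    have hc := (lambdaMax_mul_nonneg hR hG).trans h
    refine ⟨hc, dotProduct_mulVec_le_of_spectrum_le (posSemidef_conj hR hG).1 fun t ht => ?_⟩
    by_cases h0 : t = 0
    · exact h0.le.trans hc
    · refine (le_csSup (bddAbove_spectrum _) ?_).trans h
      rw [Matrix.mul_assoc]
      exact mem_spectrum_mul_comm h0 ht
  · rintro ⟨hc, h⟩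
    refine Real.sSup_le (fun t ht => ?_) hc
    by_cases h0 : t = 0
    · exact h0.le.trans hc
    · rw [Matrix.mul_assoc] at ht
      exact le_of_mem_spectrum h (mem_spectrum_mul_comm h0 ht)

end Product

theorem sqrt_mul_sqrt {A : Matrix (Fin n) (Fin n) ℝ} (hA : A.PosSemidef) :
    CFC.sqrt A * CFC.sqrt A = A :=
  CFC.sqrt_mul_sqrt_self A (Matrix.nonneg_iff_posSemidef.mpr hA)

theorem sqrt_transpose (A : Matrix (Fin n) (Fin n) ℝ) : (CFC.sqrt A)ᵀ = CFC.sqrt A := by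
  have := (Matrix.nonneg_iff_posSemidef.mp (CFC.sqrt_nonneg A)).1.eq
  rwa [Matrix.conjTranspose_eq_transpose_of_trivial] at this

theorem posSemidef_self_mul_transpose (A : Matrix (Fin m) (Fin n) ℝ) : (A * Aᵀ).PosSemidef := by
  have := Matrix.posSemidef_self_mul_conjTranspose A
  rwa [Matrix.conjTranspose_eq_transpose_of_trivial] at this

theorem empCov_posSemidef (X : Matrix (Fin m) (Fin n) ℝ) : (empCov X).PosSemidef :=
  (posSemidef_self_mul_transpose X).smul (inv_nonneg.mpr (Nat.cast_nonneg n))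

theorem pinv_posSemidef {A : Matrix (Fin n) (Fin n) ℝ} (hA : A.PosSemidef) :
    (pinv A).PosSemidef := by
  have h := pinv_mul_self_of_symm (sqrt_transpose A)
  rw [sqrt_mul_sqrt hA] at h
  have h2 := posSemidef_self_mul_transpose (pinv (CFC.sqrt A))
  rwa [pinv_transpose_of_symm (sqrt_transpose A), h] at h2

theorem sqBound_sqrt {A : Matrix (Fin n) (Fin n) ℝ} (hA : A.PosSemidef) :
    SqBound (CFC.sqrt A) (lambdaMax A) := by
  intro v
  rw [mulVec_dotProduct, sqrt_transpose, Matrix.mulVec_mulVec, sqrt_mul_sqrt hA]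
  exact dotProduct_mulVec_le_lambdaMax hA.1 v

/-- Since `(A^{1/2})†` squares to `A†`, the Gram matrix of the product is `B^{1/2} A† B^{1/2}`. -/
theorem sqBound_pinv_sqrt_mul_sqrt {A B : Matrix (Fin n) (Fin n) ℝ} (hA : A.PosSemidef)
    (hB : B.PosSemidef) :
    SqBound (pinv (CFC.sqrt A) * CFC.sqrt B) (lambdaMax (B * pinv A)) := by
  have h := (lambdaMax_mul_le_iff (sqrt_transpose B) (pinv_posSemidef hA)).mp le_rfl
  rw [sqrt_mul_sqrt hB] at h
  intro v
  have e : (pinv (CFC.sqrt A) * CFC.sqrt B)ᵀ * (pinv (CFC.sqrt A) * CFC.sqrt B)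
      = CFC.sqrt B * pinv A * CFC.sqrt B := by
    have h := pinv_mul_self_of_symm (sqrt_transpose A)
    rw [sqrt_mul_sqrt hA] at h
    rw [Matrix.transpose_mul, sqrt_transpose, pinv_transpose_of_symm (sqrt_transpose A), ← h]
    simp only [Matrix.mul_assoc]
  rw [mulVec_dotProduct, Matrix.mulVec_mulVec, e]
  exact h.2 v

end Eigenvalues

/-! ### The deterministic error bound -/

section Deterministic

variable {dx dy n : ℕ}

theorem projPerp_eq (X : Matrix (Fin dx) (Fin n) ℝ) : projPerp X = 1 - X * pinv X := by
  have hX := isMoorePenrose_pinv X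
  unfold projPerp
  rw [LinearEquiv.symm_apply_eq]
  refine LinearMap.ext fun v => ?_
  rw [ContinuousLinearMap.coe_coe]
  have hv : Matrix.toEuclideanLin (1 - X * pinv X) v
      = v - Matrix.toEuclideanLin X (Matrix.toEuclideanLin (pinv X) v) := by
    ext i
    simp [Matrix.toLpLin_apply, Matrix.mulVec_mulVec]
  apply Submodule.eq_starProjection_of_mem_orthogonal
  · rw [Submodule.mem_orthogonal]
    rintro _ ⟨w, rfl⟩
    have h0 : Xᵀ * (1 - X * pinv X) = 0 := by
      have := congrArg Matrix.transpose hX.mul_mul_left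
      rw [Matrix.transpose_mul, hX.symm_left] at this
      rw [Matrix.mul_sub, Matrix.mul_one, this, sub_self]
    rw [PiLp.inner_apply]
    have h1 : (X *ᵥ w.ofLp) ⬝ᵥ ((1 - X * pinv X) *ᵥ v.ofLp) = 0 := by
      rw [mulVec_dotProduct, Matrix.mulVec_mulVec, h0, Matrix.zero_mulVec, dotProduct_zero]
    simpa [Matrix.toLpLin_apply, Matrix.sub_mulVec, dotProduct, mul_comm] using h1
  · rw [hv, sub_sub_cancel]
    exact Submodule.le_orthogonal_orthogonal _ (LinearMap.mem_range_self _ _)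

theorem rank_sub_le (A B : Matrix (Fin dy) (Fin dx) ℝ) : (A - B).rank ≤ A.rank + B.rank := by
  refine (Submodule.finrank_mono (t := LinearMap.range A.mulVecLin ⊔ LinearMap.range B.mulVecLin)
    ?_).trans (Submodule.finrank_add_le_finrank_add_finrank _ _)
  rintro _ ⟨v, rfl⟩
  rw [Matrix.mulVecLin_apply, Matrix.sub_mulVec]
  exact Submodule.sub_mem _ (Submodule.mem_sup_left ⟨v, rfl⟩) (Submodule.mem_sup_right ⟨v, rfl⟩)

/-- The comparison is with `K S`, a competitor of rank at most `r` for the truncation. Staying in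
operator norm until the rank of `T - K S` is used keeps the noise contribution proportional to `r`.
-/
theorem excess_le {r : ℕ} (hrn : r < n) {A₀ Astar A : Matrix (Fin dy) (Fin dx) ℝ}
    {X : Matrix (Fin dx) (Fin n) ℝ} {Y : Matrix (Fin dy) (Fin n) ℝ}
    (hA : IsLoRASolution r A₀ X Y A) {Sx : Matrix (Fin dx) (Fin dx) ℝ} (hSx : Sx.PosSemidef)
    {e : ℝ} (he : 0 ≤ e) (hE : SqBound (Y - Astar * X) e) :
    frobSq ((A - Astar) * CFC.sqrt Sx) ≤
      3 * (frobSq ((Astar - A₀) * projPerp X * CFC.sqrt Sx)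
        + lambdaMax Sx * (r * singularValue (Astar - A₀) (r + 1) ^ 2
          + ∑ i ∈ Finset.Icc (r + 1) (min n dy), singularValue (Astar - A₀) i ^ 2)
        + 16 * r * (singularValue (Astar - A₀) (r + 1) ^ 2 * lambdaMax (empCov X) + e / n)
          * lambdaMax (Sx * pinv (empCov X))) := by
  obtain ⟨T, hT, rfl⟩ := hA
  have hn : (n : ℝ) ≠ 0 := Nat.cast_ne_zero.mpr (by omega)
  have hn0 : (0 : ℝ) ≤ n := Nat.cast_nonneg n
  set Δ := Astar - A₀ with hΔ
  set R := CFC.sqrt Sx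
  have hSig := empCov_posSemidef X
  set S := CFC.sqrt (empCov X) with hS
  have hSS : S * S = empCov X := sqrt_mul_sqrt hSig
  have hSt : Sᵀ = S := sqrt_transpose _
  set σ := singularValue Δ (r + 1) ^ 2 with hσ
  have hσ0 : 0 ≤ σ := sq_nonneg _
  set L := lambdaMax (empCov X)
  have hL : 0 ≤ L := lambdaMax_nonneg hSig
  have hX := isMoorePenrose_pinv X
  -- `S Sᵀ` and `X Xᵀ` agree up to the factor `1/n`, so `S` and `X` have the same range.
  have hP : S * pinv S = X * pinv X := by
    refine mul_pinv_eq_of_mul_transpose_eq (c := (n : ℝ)⁻¹) (inv_ne_zero hn) ?_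
    rw [hSt, hSS]; rfl
  have hPS : X * pinv X * S = S := by
    rw [← hP]; exact (isMoorePenrose_pinv S).mul_mul_left
  obtain ⟨K, hK, hKσ, hKP⟩ := exists_lowRank_approx Δ hrn.le
  set N := (Y - Astar * X) * (pinv X * S) with hN
  have hM : fftUpdate A₀ X Y * S = Δ * S + N := by
    have : Y - A₀ * X = Δ * X + (Y - Astar * X) := by
      rw [hΔ, Matrix.sub_mul]; abel
    unfold fftUpdate
    rw [this, Matrix.add_mul, Matrix.add_mul, Matrix.mul_assoc Δ, Matrix.mul_assoc Δ, hPS,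
      Matrix.mul_assoc]
  -- `(X† S)(X† S)ᵀ` is `1/n` times the projection `X† X`.
  have hXS : SqBound (pinv X * S) (1 / n) := by
    have h1 : SqBound (pinv X * S)ᵀ (1 / n) := by
      intro v
      have h2 : (pinv X * S) * (pinv X * S)ᵀ = (n : ℝ)⁻¹ • (pinv X * X) := by
        calc (pinv X * S) * (pinv X * S)ᵀ = pinv X * (S * S) * (pinv X)ᵀ := by
              rw [Matrix.transpose_mul, hSt]; simp only [Matrix.mul_assoc]
          _ = (n : ℝ)⁻¹ • (pinv X * X * (pinv X * X)ᵀ) := by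
              rw [hSS, empCov, Matrix.transpose_mul]
              simp only [Matrix.mul_smul, Matrix.smul_mul, Matrix.mul_assoc]
          _ = _ := by rw [hX.symm_right, ← Matrix.mul_assoc, hX.mul_mul_right]
      rw [mulVec_dotProduct, Matrix.transpose_transpose, Matrix.mulVec_mulVec, h2,
        Matrix.smul_mulVec, dotProduct_smul, smul_eq_mul, one_div]
      refine mul_le_mul_of_nonneg_left ?_ (inv_nonneg.mpr hn0)
      have h3 : pinv X * X * (pinv X * X) = pinv X * X := by
        rw [← Matrix.mul_assoc, hX.mul_mul_right]
      have h4 := SqBound.of_isIdempotent hX.symm_right h3 v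
      rwa [mulVec_dotProduct, hX.symm_right, Matrix.mulVec_mulVec, h3, one_mul] at h4
    have h5 := h1.transpose (by positivity)
    rwa [Matrix.transpose_transpose] at h5
  have hNb : SqBound N (e / n) := by
    have := hE.mul hXS he
    rwa [mul_one_div] at this
  set q := σ * L + e / n with hq
  have hq0 : 0 ≤ q := by positivity
  have hMK : SqBound (fftUpdate A₀ X Y * S - K * S) (2 * q) := by
    have h1 : fftUpdate A₀ X Y * S - K * S = (Δ - K) * S + N := by
      rw [hM, Matrix.sub_mul Δ K]; abel
    rw [h1]
    exact (hKσ.mul (sqBound_sqrt hSig) hσ0).add hNb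
  have hMT := hT.sqBound_sub ((Matrix.rank_mul_le_left K S).trans hK) (by positivity) hMK
  -- Both `T` and `K S` are within squared distance `2q` of the truncated matrix, and `8 = 2 * (2 +
  -- 2)`.
  have hTK : SqBound (T - K * S) (8 * q) := by
    have h1 : T - K * S = (fftUpdate A₀ X Y * S - K * S) + -(fftUpdate A₀ X Y * S - T) := by abel
    rw [h1]
    exact (hMK.add hMT.neg).mono (by linarith)
  have hTKr : ((T - K * S).rank : ℝ) ≤ 2 * r := by
    have h1 := rank_sub_le T (K * S)
    have h2 := (Matrix.rank_mul_le_left K S).trans hK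
    have h3 := hT.rank_le
    have h4 : (T - K * S).rank ≤ 2 * r := by omega
    exact_mod_cast h4
  have hF : frobSq (T - K * S) ≤ 16 * r * q := by
    refine (frobSq_le_rank_mul hTK (by positivity)).trans ?_
    nlinarith [mul_le_mul_of_nonneg_left hTKr hq0]
  have hdecomp : (A₀ + T * pinv S - Astar) * R
      = Δ * projPerp X * (-R) + (Δ - K) * (X * pinv X) * (-R) + (T - K * S) * (pinv S * R) := by
    have h1 : A₀ + T * pinv S - Astar
        = -(Δ * projPerp X) - (Δ - K) * (X * pinv X) + (T - K * S) * pinv S := by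
      rw [projPerp_eq, Matrix.sub_mul T, Matrix.mul_assoc K, hP, Matrix.mul_sub, Matrix.mul_one,
        Matrix.sub_mul Δ K, hΔ]
      abel
    rw [h1, Matrix.add_mul, Matrix.sub_mul, Matrix.neg_mul, Matrix.mul_neg, Matrix.mul_neg,
      Matrix.mul_assoc (T - K * S)]
    abel
  rw [hdecomp]
  refine (frobSq_add_add_le _ _ _).trans ?_
  refine mul_le_mul_of_nonneg_left (add_le_add (add_le_add ?_ ?_) ?_) (by norm_num)
  · rw [Matrix.mul_neg, frobSq_neg]
  · rw [Matrix.mul_neg, frobSq_neg]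
    have hl := lambdaMax_nonneg hSx
    refine (frobSq_mul_le_right (sqBound_sqrt hSx) hl).trans (mul_le_mul_of_nonneg_left ?_ hl)
    refine hKP _ hX.symm_left (mul_pinv_idem X) ((trace_mul_pinv_le X).trans ?_)
    exact Nat.cast_le.mpr (Matrix.rank_le_width X)
  · have hl : 0 ≤ lambdaMax (Sx * pinv (empCov X)) := by
      have := lambdaMax_mul_nonneg (sqrt_transpose Sx) (pinv_posSemidef hSig)
      rwa [sqrt_mul_sqrt hSx] at this
    refine (frobSq_mul_le_right (sqBound_pinv_sqrt_mul_sqrt hSig hSx) hl).trans ?_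
    rw [mul_comm]
    exact mul_le_mul_of_nonneg_right hF hl

end Deterministic

/-! ### The operator norm of a Gaussian matrix -/

section GaussianMatrix

open Metric

variable {n d : ℕ}

/-- The matrix with given columns, as a continuous linear map. -/
noncomputable def columnsCLM (e : Fin n → EuclideanSpace ℝ (Fin d)) :
    EuclideanSpace ℝ (Fin n) →L[ℝ] EuclideanSpace ℝ (Fin d) :=
  (Matrix.toEuclideanLin (columns e)).toContinuousLinearMap

theorem columnsCLM_apply (e : Fin n → EuclideanSpace ℝ (Fin d)) (u : EuclideanSpace ℝ (Fin n)) :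
    columnsCLM e u = ∑ i, u i • e i := by
  ext j
  simp [columnsCLM, Matrix.toLpLin_apply, columns, Matrix.mulVec, dotProduct, mul_comm]

theorem inner_columnsCLM (e : Fin n → EuclideanSpace ℝ (Fin d)) (u : EuclideanSpace ℝ (Fin n))
    (v : EuclideanSpace ℝ (Fin d)) :
    inner ℝ v (columnsCLM e u) = ∑ i, u i * inner ℝ v (e i) := by
  simp [columnsCLM_apply, inner_sum, inner_smul_right]

theorem continuous_columnsCLM :
    Continuous (columnsCLM : (Fin n → EuclideanSpace ℝ (Fin d)) → _) := by
  let F : (Fin n → EuclideanSpace ℝ (Fin d)) →ₗ[ℝ]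
      (EuclideanSpace ℝ (Fin n) →L[ℝ] EuclideanSpace ℝ (Fin d)) :=
    { toFun := columnsCLM
      map_add' := fun e f => by
        ext1 u; simp [columnsCLM_apply, Finset.sum_add_distrib]
      map_smul' := fun c e => by
        ext1 u; simp [columnsCLM_apply, Finset.smul_sum, smul_comm c] }
  exact F.continuous_of_finiteDimensional

theorem sqBound_columns (e : Fin n → EuclideanSpace ℝ (Fin d)) :
    SqBound (columns e) (‖columnsCLM e‖ ^ 2) := by
  intro v
  have h := (columnsCLM e).le_opNorm (WithLp.toLp 2 v)
  have h2 := pow_le_pow_left₀ (norm_nonneg _) h 2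
  rw [mul_pow, EuclideanSpace.norm_sq_eq, EuclideanSpace.norm_sq_eq] at h2
  simpa [columnsCLM, Matrix.toLpLin_apply, dotProduct, sq] using h2

/-- The operator norm is approached by the bilinear form on a product of balls of fixed radius. -/
theorem exists_ball_le_inner {E F : Type*} [NormedAddCommGroup E] [InnerProductSpace ℝ E]
    [NormedAddCommGroup F] [InnerProductSpace ℝ F] (T : E →L[ℝ] F) :
    ∃ u₀ : E, ∃ v₀ : F, ‖u₀‖ ≤ 1 ∧ ‖v₀‖ ≤ 1 ∧
      ∀ u ∈ ball u₀ (1 / 4), ∀ v ∈ ball v₀ (1 / 4), ‖T‖ / 4 ≤ inner ℝ v (T u) := by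
  rcases (norm_nonneg T).eq_or_lt with h0 | h0
  · refine ⟨0, 0, by simp, by simp, fun u _ v _ => ?_⟩
    have : T = 0 := norm_eq_zero.mp h0.symm
    simp [this]
  · obtain ⟨u₀, hu₀, hT⟩ := T.exists_lt_apply_of_lt_opNorm (r := 9 / 10 * ‖T‖) (by linarith)
    have hpos : 0 < ‖T u₀‖ := by nlinarith
    refine ⟨u₀, ‖T u₀‖⁻¹ • T u₀, hu₀.le, ?_, fun u hu v hv => ?_⟩
    · rw [norm_smul, norm_inv, norm_norm, inv_mul_cancel₀ hpos.ne']
    · rw [mem_ball, dist_eq_norm] at hu hv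
      set v₀ := ‖T u₀‖⁻¹ • T u₀
      have hv₀ : inner ℝ v₀ (T u₀) = ‖T u₀‖ := by
        simp only [v₀, real_inner_smul_left, real_inner_self_eq_norm_sq]
        field_simp
      have hv₀' : ‖v₀‖ = 1 := by rw [norm_smul, norm_inv, norm_norm, inv_mul_cancel₀ hpos.ne']
      have e1 : inner ℝ v (T u)
          = inner ℝ v₀ (T u₀) + inner ℝ (v - v₀) (T u₀) + inner ℝ v (T (u - u₀)) := by
        rw [map_sub, inner_sub_left, inner_sub_right]; ring
      have h1 : -(1 / 4 * ‖T‖) ≤ inner ℝ (v - v₀) (T u₀) := by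
        refine (neg_le_neg ?_).trans (neg_le_of_abs_le (abs_real_inner_le_norm _ _))
        refine mul_le_mul hv.le ((T.le_opNorm u₀).trans ?_) (norm_nonneg _) (by norm_num)
        exact mul_le_of_le_one_right h0.le hu₀.le
      have hvn : ‖v‖ ≤ 5 / 4 := by
        have := norm_le_norm_add_norm_sub' v v₀
        linarith
      have h2 : -(5 / 4 * (‖T‖ * (1 / 4))) ≤ inner ℝ v (T (u - u₀)) := by
        refine (neg_le_neg ?_).trans (neg_le_of_abs_le (abs_real_inner_le_norm _ _))
        refine mul_le_mul hvn ((T.le_opNorm _).trans ?_) (norm_nonneg _) (by norm_num)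
        exact mul_le_mul_of_nonneg_left hu.le h0.le
      rw [e1, hv₀]
      linarith

/-- The product of the uniform measures on two balls of radius `5 / 4`. -/
noncomputable def ballProd (n d : ℕ) :
    Measure (EuclideanSpace ℝ (Fin n) × EuclideanSpace ℝ (Fin d)) :=
  (volume.restrict (ball 0 (5 / 4))).prod (volume.restrict (ball 0 (5 / 4)))

instance : IsFiniteMeasure (ballProd n d) := by
  have (k : ℕ) : IsFiniteMeasure
      ((volume : Measure (EuclideanSpace ℝ (Fin k))).restrict (ball 0 (5 / 4))) :=
    isFiniteMeasure_restrict.mpr measure_ball_lt_top.ne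
  unfold ballProd
  infer_instance

/-- The volume of the product of two balls of radius `1 / 4`. -/
noncomputable def smallVol (n d : ℕ) : ℝ≥0∞ :=
  volume (ball (0 : EuclideanSpace ℝ (Fin n)) (1 / 4))
    * volume (ball (0 : EuclideanSpace ℝ (Fin d)) (1 / 4))

theorem smallVol_ne_zero : smallVol n d ≠ 0 :=
  mul_ne_zero (measure_ball_pos _ _ (by norm_num)).ne' (measure_ball_pos _ _ (by norm_num)).ne'

theorem smallVol_ne_top : smallVol n d ≠ ∞ :=
  ENNReal.mul_ne_top measure_ball_lt_top.ne measure_ball_lt_top.ne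

theorem ballProd_univ : ballProd n d Set.univ = ENNReal.ofReal (5 ^ (n + d)) * smallVol n d := by
  have h (k : ℕ) : volume (ball (0 : EuclideanSpace ℝ (Fin k)) (5 / 4))
      = ENNReal.ofReal (5 ^ k) * volume (ball (0 : EuclideanSpace ℝ (Fin k)) (1 / 4)) := by
    have := Measure.addHaar_ball_mul_of_pos (volume : Measure (EuclideanSpace ℝ (Fin k))) 0
      (r := 5) (by norm_num) (1 / 4)
    rw [finrank_euclideanSpace_fin] at this
    rw [← this]
    norm_num
  rw [ballProd, ← Set.univ_prod_univ, Measure.prod_prod, Measure.restrict_apply_univ,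
    Measure.restrict_apply_univ, h, h, pow_add, ENNReal.ofReal_mul (by positivity), smallVol]
  ring

/-- Restrict the integral to the two balls of radius 1/4 on which the bilinear form is at least `‖T‖
/ 4`. Their centres have norm at most 1, so they lie inside the balls of radius 5/4. -/
theorem exp_opNorm_mul_le (T : EuclideanSpace ℝ (Fin n) →L[ℝ] EuclideanSpace ℝ (Fin d)) {t : ℝ}
    (ht : 0 ≤ t) :
    ENNReal.ofReal (Real.exp (t * (‖T‖ / 4))) * smallVol n d
      ≤ ∫⁻ p, ENNReal.ofReal (Real.exp (t * inner ℝ p.2 (T p.1))) ∂ballProd n d := by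
  obtain ⟨u₀, v₀, hu₀, hv₀, h⟩ := exists_ball_le_inner T
  have hmeas (k : ℕ) (w : EuclideanSpace ℝ (Fin k)) (hw : ‖w‖ ≤ 1) :
      volume.restrict (ball 0 (5 / 4)) (ball w (1 / 4))
        = volume (ball (0 : EuclideanSpace ℝ (Fin k)) (1 / 4)) := by
    rw [Measure.restrict_apply measurableSet_ball, Set.inter_eq_left.mpr,
      Measure.addHaar_ball_center]
    refine ball_subset_ball' ?_
    rw [dist_zero_right]
    linarith
  calc ENNReal.ofReal (Real.exp (t * (‖T‖ / 4))) * smallVol n d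
      = ENNReal.ofReal (Real.exp (t * (‖T‖ / 4)))
          * ballProd n d (ball u₀ (1 / 4) ×ˢ ball v₀ (1 / 4)) := by
        rw [ballProd, Measure.prod_prod, hmeas _ _ hu₀, hmeas _ _ hv₀, smallVol]
    _ = ∫⁻ _ in ball u₀ (1 / 4) ×ˢ ball v₀ (1 / 4),
          ENNReal.ofReal (Real.exp (t * (‖T‖ / 4))) ∂ballProd n d := by
        rw [setLIntegral_const]
    _ ≤ ∫⁻ p in ball u₀ (1 / 4) ×ˢ ball v₀ (1 / 4),
          ENNReal.ofReal (Real.exp (t * inner ℝ p.2 (T p.1))) ∂ballProd n d := by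
        refine setLIntegral_mono' (measurableSet_ball.prod measurableSet_ball) fun p hp => ?_
        exact ENNReal.ofReal_le_ofReal (Real.exp_le_exp.mpr
          (mul_le_mul_of_nonneg_left (h _ hp.1 _ hp.2) ht))
    _ ≤ _ := setLIntegral_le_lintegral _ _

variable {S : Matrix (Fin d) (Fin d) ℝ}

theorem integral_exp_inner_gaussian (hS : S.PosSemidef) (v : EuclideanSpace ℝ (Fin d)) (t : ℝ) :
    ∫ z, Real.exp (t * inner ℝ v z) ∂multivariateGaussian 0 S
      = Real.exp ((v.ofLp ⬝ᵥ S *ᵥ v.ofLp) * t ^ 2 / 2) := by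
  have h := IsGaussian.map_eq_gaussianReal (μ := multivariateGaussian 0 S) (innerSL ℝ v)
  have hm : (multivariateGaussian 0 S)[innerSL ℝ v] = 0 := by
    rw [ContinuousLinearMap.integral_comp_id_comm IsGaussian.integrable_id]
    simp
  have hv : Var[innerSL ℝ v; multivariateGaussian 0 S] = v.ofLp ⬝ᵥ S *ᵥ v.ofLp := by
    rw [← covarianceBilin_multivariateGaussian (μ := 0) hS,
      covarianceBilin_self IsGaussian.memLp_two_id]
    rfl
  rw [hm, hv] at h
  have h2 := mgf_gaussianReal h t
  have h3 : 0 ≤ v.ofLp ⬝ᵥ S *ᵥ v.ofLp := by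
    simpa using hS.dotProduct_mulVec_nonneg v.ofLp
  rw [Real.coe_toNNReal _ h3, zero_mul, zero_add] at h2
  exact h2

theorem lintegral_exp_columnsCLM_le (hS : S.PosSemidef) {l : ℝ}
    (hl : ∀ v : Fin d → ℝ, v ⬝ᵥ (S *ᵥ v) ≤ l * (v ⬝ᵥ v)) (u : EuclideanSpace ℝ (Fin n))
    (v : EuclideanSpace ℝ (Fin d)) (t : ℝ) :
    ∫⁻ e, ENNReal.ofReal (Real.exp (t * inner ℝ v (columnsCLM e u)))
        ∂Measure.pi (fun _ : Fin n => multivariateGaussian 0 S)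
      ≤ ENNReal.ofReal (Real.exp (t ^ 2 * l * (‖u‖ ^ 2 * ‖v‖ ^ 2) / 2)) := by
  have e1 : ∀ e : Fin n → EuclideanSpace ℝ (Fin d),
      Real.exp (t * inner ℝ v (columnsCLM e u)) = ∏ i, Real.exp (t * u i * inner ℝ v (e i)) := by
    intro e
    rw [inner_columnsCLM, Finset.mul_sum, Real.exp_sum]
    simp only [mul_assoc]
  -- The integral of a non-integrable function is `0` by convention, whereas this integral is a
  -- positive exponential.
  have hint : ∀ i, Integrable (fun z => Real.exp (t * u i * inner ℝ v z))
      (multivariateGaussian 0 S) := by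
    intro i
    by_contra hc
    have := integral_exp_inner_gaussian hS v (t * u i)
    rw [integral_undef hc] at this
    exact (Real.exp_pos _).ne this
  have hint2 : Integrable (fun e : Fin n → EuclideanSpace ℝ (Fin d) =>
      ∏ i, Real.exp (t * u i * inner ℝ v (e i)))
      (Measure.pi (fun _ : Fin n => multivariateGaussian 0 S)) :=
    Integrable.fintype_prod (f := fun i z => Real.exp (t * u i * inner ℝ v z)) hint
  simp only [e1]
  rw [← ofReal_integral_eq_lintegral_ofReal hint2
    (Filter.Eventually.of_forall fun e => Finset.prod_nonneg fun i _ => (Real.exp_pos _).le),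
    integral_fintype_prod_eq_prod (fun i z => Real.exp (t * u i * inner ℝ v z))]
  refine ENNReal.ofReal_le_ofReal ?_
  simp only [integral_exp_inner_gaussian hS]
  rw [← Real.exp_sum]
  refine Real.exp_le_exp.mpr ?_
  have hu : ‖u‖ ^ 2 = ∑ i, u i ^ 2 := by simp [EuclideanSpace.norm_sq_eq]
  have hv : ‖v‖ ^ 2 = v.ofLp ⬝ᵥ v.ofLp := by
    rw [EuclideanSpace.norm_sq_eq]; simp [dotProduct, ← sq]
  calc ∑ i, (v.ofLp ⬝ᵥ S *ᵥ v.ofLp) * (t * u i) ^ 2 / 2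
      = (v.ofLp ⬝ᵥ S *ᵥ v.ofLp) * (t ^ 2 * ‖u‖ ^ 2 / 2) := by
        rw [hu, Finset.mul_sum, Finset.sum_div, Finset.mul_sum]
        exact Finset.sum_congr rfl fun i _ => by ring
    _ ≤ (l * ‖v‖ ^ 2) * (t ^ 2 * ‖u‖ ^ 2 / 2) := by
        rw [hv]; exact mul_le_mul_of_nonneg_right (hl _) (by positivity)
    _ = _ := by ring

theorem lintegral_exp_opNorm_le (hS : S.PosSemidef) {l : ℝ} (hl0 : 0 ≤ l)
    (hl : ∀ v : Fin d → ℝ, v ⬝ᵥ (S *ᵥ v) ≤ l * (v ⬝ᵥ v)) {t : ℝ} (ht : 0 ≤ t) :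
    ∫⁻ e, ENNReal.ofReal (Real.exp (t * (‖columnsCLM e‖ / 4)))
        ∂Measure.pi (fun _ : Fin n => multivariateGaussian 0 S)
      ≤ ENNReal.ofReal (Real.exp (5 / 4 * (t ^ 2 * l))) * ENNReal.ofReal (5 ^ (n + d)) := by
  set γ := Measure.pi (fun _ : Fin n => multivariateGaussian 0 S)
  have hc : Continuous fun q : (Fin n → EuclideanSpace ℝ (Fin d)) ×
      (EuclideanSpace ℝ (Fin n) × EuclideanSpace ℝ (Fin d)) =>
      t * inner ℝ q.2.2 (columnsCLM q.1 q.2.1) := by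
    simp only [inner_columnsCLM]
    fun_prop
  have hmeas : Measurable fun q : (Fin n → EuclideanSpace ℝ (Fin d)) ×
      (EuclideanSpace ℝ (Fin n) × EuclideanSpace ℝ (Fin d)) =>
      ENNReal.ofReal (Real.exp (t * inner ℝ q.2.2 (columnsCLM q.1 q.2.1))) :=
    (Real.continuous_exp.comp hc).measurable.ennreal_ofReal
  have key : (∫⁻ e, ENNReal.ofReal (Real.exp (t * (‖columnsCLM e‖ / 4))) ∂γ) * smallVol n d
      ≤ (ENNReal.ofReal (Real.exp (5 / 4 * (t ^ 2 * l))) * ENNReal.ofReal (5 ^ (n + d)))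
        * smallVol n d := by
    calc (∫⁻ e, ENNReal.ofReal (Real.exp (t * (‖columnsCLM e‖ / 4))) ∂γ) * smallVol n d
        = ∫⁻ e, ENNReal.ofReal (Real.exp (t * (‖columnsCLM e‖ / 4))) * smallVol n d ∂γ :=
          (lintegral_mul_const' _ _ smallVol_ne_top).symm
      _ ≤ ∫⁻ e, ∫⁻ p, ENNReal.ofReal (Real.exp (t * inner ℝ p.2 (columnsCLM e p.1)))
            ∂ballProd n d ∂γ := lintegral_mono fun e => exp_opNorm_mul_le _ ht
      _ = ∫⁻ p, ∫⁻ e, ENNReal.ofReal (Real.exp (t * inner ℝ p.2 (columnsCLM e p.1)))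
            ∂γ ∂ballProd n d := lintegral_lintegral_swap hmeas.aemeasurable
      _ ≤ ∫⁻ _, ENNReal.ofReal (Real.exp (5 / 4 * (t ^ 2 * l))) ∂ballProd n d := by
          refine lintegral_mono_ae ?_
          have hae : ∀ᵐ p ∂ballProd n d, p ∈ ball (0 : EuclideanSpace ℝ (Fin n)) (5 / 4) ×ˢ
              ball (0 : EuclideanSpace ℝ (Fin d)) (5 / 4) := by
            rw [ballProd, Measure.prod_restrict]
            exact ae_restrict_mem (measurableSet_ball.prod measurableSet_ball)
          filter_upwards [hae] with p hp
          refine (lintegral_exp_columnsCLM_le hS hl p.1 p.2 t).trans ?_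
          refine ENNReal.ofReal_le_ofReal (Real.exp_le_exp.mpr ?_)
          have h1 : ‖p.1‖ ^ 2 ≤ (5 / 4) ^ 2 :=
            pow_le_pow_left₀ (norm_nonneg _) (mem_ball_zero_iff.mp hp.1).le 2
          have h2 : ‖p.2‖ ^ 2 ≤ (5 / 4) ^ 2 :=
            pow_le_pow_left₀ (norm_nonneg _) (mem_ball_zero_iff.mp hp.2).le 2
          -- `(5/4)^4 = 625/256 < 5/2`; halving gives the exponent `5/4`.
          have h3 : ‖p.1‖ ^ 2 * ‖p.2‖ ^ 2 ≤ 5 / 2 :=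
            (mul_le_mul h1 h2 (sq_nonneg _) (by norm_num)).trans (by norm_num)
          have := mul_le_mul_of_nonneg_left h3 (mul_nonneg (sq_nonneg t) hl0)
          linarith
      _ = _ := by rw [lintegral_const, ballProd_univ, mul_assoc]
  exact (ENNReal.mul_le_mul_iff_left smallVol_ne_zero smallVol_ne_top).mp key

/-- Beyond `L`, split `s² ≤ 2L² + 2(s - L)²` and use `x² / 2 ≤ exp x`. This turns an exponential
moment into a second moment without integrating tails. -/
theorem sq_le_add_exp {s L : ℝ} (hs : 0 ≤ s) (hL : 0 ≤ L) :
    s ^ 2 ≤ 2 * L ^ 2 + 4 * Real.exp (-L) * Real.exp s := by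
  rw [mul_assoc, ← Real.exp_add]
  rcases le_total s L with h | h
  · nlinarith [Real.exp_pos (-L + s)]
  · have := Real.quadratic_le_exp_of_nonneg (x := -L + s) (by linarith)
    nlinarith [sq_nonneg (s - 2 * L)]

theorem lintegral_opNorm_sq_le_of_pos (hS : S.PosSemidef) {l : ℝ} (hl0 : 0 < l)
    (hl : ∀ v : Fin d → ℝ, v ⬝ᵥ (S *ᵥ v) ≤ l * (v ⬝ᵥ v)) (hn : 0 < n) :
    ∫⁻ e, ENNReal.ofReal (‖columnsCLM e‖ ^ 2)
        ∂Measure.pi (fun _ : Fin n => multivariateGaussian 0 S)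
      ≤ ENNReal.ofReal (576 * (n + d) * l) := by
  set γ := Measure.pi (fun _ : Fin n => multivariateGaussian 0 S)
  set D : ℝ := n + d with hD
  have hD1 : 1 ≤ D := by
    have : (1 : ℝ) ≤ n := Nat.one_le_cast.mpr hn
    have : (0 : ℝ) ≤ d := Nat.cast_nonneg d
    linarith
  -- This `t` makes the Gaussian exponent `5D/4`, of the same order as the entropy factor `5^(n + d)
  -- ≤ exp(11D/4)`. Together they give `exp(4D)`, which the cutoff `L = 4D` cancels.
  set t := √(D / l) with ht
  have ht2 : t ^ 2 = D / l := Real.sq_sqrt (by positivity)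
  have htl : t ^ 2 * l = D := by rw [ht2]; field_simp
  have htpos : 0 < t := Real.sqrt_pos.mpr (by positivity)
  have hpt : ∀ e : Fin n → EuclideanSpace ℝ (Fin d), ENNReal.ofReal (‖columnsCLM e‖ ^ 2)
      ≤ ENNReal.ofReal (512 * D * l) + ENNReal.ofReal (64 * l / D * Real.exp (-(4 * D)))
        * ENNReal.ofReal (Real.exp (t * (‖columnsCLM e‖ / 4))) := by
    intro e
    rw [← ENNReal.ofReal_mul (by positivity), ← ENNReal.ofReal_add (by positivity) (by positivity)]
    refine ENNReal.ofReal_le_ofReal ?_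
    have h := sq_le_add_exp (s := t * (‖columnsCLM e‖ / 4)) (L := 4 * D) (by positivity)
      (by positivity)
    have h2 := mul_le_mul_of_nonneg_left h (show 0 ≤ 16 * l / D by positivity)
    have e1 : 16 * l / D * (t * (‖columnsCLM e‖ / 4)) ^ 2 = ‖columnsCLM e‖ ^ 2 := by
      rw [mul_pow, ht2]; field_simp; ring
    rw [e1] at h2
    refine h2.trans (le_of_eq ?_)
    field_simp
    ring
  have hexp : ENNReal.ofReal (Real.exp (5 / 4 * (t ^ 2 * l))) * ENNReal.ofReal (5 ^ (n + d))
      ≤ ENNReal.ofReal (Real.exp (4 * D)) := by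
    rw [← ENNReal.ofReal_mul (by positivity), htl]
    refine ENNReal.ofReal_le_ofReal ?_
    have h5 : (5 : ℝ) ≤ Real.exp (11 / 4) := by
      have := Real.quadratic_le_exp_of_nonneg (x := 11 / 4) (by norm_num)
      linarith
    have h6 : (5 : ℝ) ^ (n + d) ≤ Real.exp (11 / 4 * D) := by
      refine (pow_le_pow_left₀ (by norm_num) h5 _).trans (le_of_eq ?_)
      rw [← Real.exp_nat_mul, hD]
      push_cast
      ring_nf
    calc Real.exp (5 / 4 * D) * 5 ^ (n + d) ≤ Real.exp (5 / 4 * D) * Real.exp (11 / 4 * D) :=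
          mul_le_mul_of_nonneg_left h6 (Real.exp_pos _).le
      _ = _ := by rw [← Real.exp_add]; ring_nf
  calc ∫⁻ e, ENNReal.ofReal (‖columnsCLM e‖ ^ 2) ∂γ
      ≤ ∫⁻ e, (ENNReal.ofReal (512 * D * l) + ENNReal.ofReal (64 * l / D * Real.exp (-(4 * D)))
        * ENNReal.ofReal (Real.exp (t * (‖columnsCLM e‖ / 4)))) ∂γ := lintegral_mono hpt
    _ = ENNReal.ofReal (512 * D * l) + ENNReal.ofReal (64 * l / D * Real.exp (-(4 * D)))
        * ∫⁻ e, ENNReal.ofReal (Real.exp (t * (‖columnsCLM e‖ / 4))) ∂γ := by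
      rw [lintegral_add_left measurable_const, lintegral_const_mul' _ _ ENNReal.ofReal_ne_top,
        lintegral_const, measure_univ, mul_one]
    _ ≤ ENNReal.ofReal (512 * D * l) + ENNReal.ofReal (64 * l / D * Real.exp (-(4 * D)))
        * ENNReal.ofReal (Real.exp (4 * D)) := by
      gcongr
      exact (lintegral_exp_opNorm_le hS hl0.le hl htpos.le).trans hexp
    _ = ENNReal.ofReal (512 * D * l + 64 * l / D) := by
      rw [← ENNReal.ofReal_mul (by positivity), ← ENNReal.ofReal_add (by positivity)
        (by positivity), mul_assoc (64 * l / D), ← Real.exp_add]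
      simp
    _ ≤ ENNReal.ofReal (576 * D * l) := by
      refine ENNReal.ofReal_le_ofReal ?_
      have : 64 * l / D ≤ 64 * l * D := by
        rw [div_le_iff₀ (by positivity)]
        nlinarith [mul_le_mul_of_nonneg_left (one_le_pow₀ hD1 (n := 2)) hl0.le]
      linarith

theorem lintegral_opNorm_sq_le (hS : S.PosSemidef) (hn : 0 < n) :
    ∫⁻ e, ENNReal.ofReal (‖columnsCLM e‖ ^ 2)
        ∂Measure.pi (fun _ : Fin n => multivariateGaussian 0 S)
      ≤ ENNReal.ofReal (576 * (n + d) * lambdaMax S) := by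
  -- The choice of `t` divides by the variance bound, so a possibly zero `lambdaMax S` is approached
  -- from above.
  have hlim : Filter.Tendsto (fun a : ℝ => ENNReal.ofReal (576 * (n + d) * (lambdaMax S + a)))
      (nhdsWithin 0 (Set.Ioi 0)) (nhds (ENNReal.ofReal (576 * (n + d) * (lambdaMax S + 0)))) := by
    refine (ENNReal.continuous_ofReal.comp ?_).continuousAt.continuousWithinAt
    fun_prop
  rw [add_zero] at hlim
  refine ge_of_tendsto hlim ?_
  filter_upwards [self_mem_nhdsWithin] with a ha
  have ha' : 0 < a := ha
  refine lintegral_opNorm_sq_le_of_pos hS (by linarith [lambdaMax_nonneg hS]) (fun v => ?_) hn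
  have := dotProduct_mulVec_le_lambdaMax hS.1 v
  nlinarith [mul_nonneg ha'.le (zero_le_dotProduct_self v)]

end GaussianMatrix

/-! ### Measurability of the Moore-Penrose inverse and of largest eigenvalues -/

section Measurability

variable {m n : ℕ}

theorem transpose_mul_self_add_posDef (A : Matrix (Fin m) (Fin n) ℝ) {e : ℝ} (he : 0 < e) :
    (Aᵀ * A + e • (1 : Matrix (Fin n) (Fin n) ℝ)).PosDef := by
  have h := posSemidef_self_mul_transpose Aᵀ
  rw [Matrix.transpose_transpose] at h
  exact Matrix.PosDef.posSemidef_add h (Matrix.PosDef.one.smul he)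

/-- With `G = A†`, the matrix `W = G Gᵀ G` solves `Aᵀ A W = G`. Hence the regularized inverse is `G
- e W + e Z` with `(Aᵀ A + e) Z = e W`. Pairing with `Z` shows that no column of `Z` is longer than
that of `W`, so the error is linear in `e`. -/
theorem abs_regularized_sub_pinv_le (A : Matrix (Fin m) (Fin n) ℝ) :
    ∃ c : Fin n → Fin m → ℝ, ∀ e : ℝ, 0 < e → ∀ i j,
      |((Aᵀ * A + e • (1 : Matrix (Fin n) (Fin n) ℝ))⁻¹ * Aᵀ) i j - pinv A i j| ≤ e * c i j := by
  have hA := isMoorePenrose_pinv A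
  set G := pinv A
  set W := G * Gᵀ * G with hW
  have h1 : Aᵀ * A * G = Aᵀ := by
    have := congrArg Matrix.transpose hA.mul_mul_left
    rwa [Matrix.transpose_mul, hA.symm_left, ← Matrix.mul_assoc] at this
  have h2 : Aᵀ * A * W = G := by
    calc Aᵀ * A * W = (Aᵀ * A * G) * Gᵀ * G := by rw [hW]; simp only [Matrix.mul_assoc]
      _ = (G * A)ᵀ * G := by rw [h1, Matrix.transpose_mul]
      _ = G := by rw [hA.symm_right, hA.mul_mul_right]
  refine ⟨fun i j => |W i j| + √(∑ k, W k j ^ 2), fun e he i j => ?_⟩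
  set B := Aᵀ * A + e • (1 : Matrix (Fin n) (Fin n) ℝ) with hB
  have hu : IsUnit B.det := by
    rw [← Matrix.isUnit_iff_isUnit_det]
    exact (transpose_mul_self_add_posDef A he).isUnit
  set Z := e • (B⁻¹ * W) with hZ
  have hBZ : B * Z = e • W := by
    rw [hZ, Matrix.mul_smul, ← Matrix.mul_assoc, Matrix.mul_nonsing_inv _ hu, Matrix.one_mul]
  have h3 : B⁻¹ * Aᵀ = G - e • W + e • Z := by
    have : B * (G - e • W + e • Z) = Aᵀ := by
      rw [Matrix.mul_add, Matrix.mul_smul, hBZ, Matrix.mul_sub, Matrix.mul_smul, hB,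
        Matrix.add_mul, Matrix.add_mul, h1, h2, Matrix.smul_mul, Matrix.one_mul, Matrix.smul_mul,
        Matrix.one_mul, smul_add]
      abel
    rw [← this, ← Matrix.mul_assoc, Matrix.nonsing_inv_mul _ hu, Matrix.one_mul]
  have h4 : |Z i j| ≤ √(∑ k, W k j ^ 2) := by
    have h5 : B *ᵥ (Zᵀ j) = e • (Wᵀ j) := by
      ext k
      exact congrFun (congrFun hBZ k) j
    have h6 : e * (Zᵀ j ⬝ᵥ Zᵀ j) ≤ e * (Zᵀ j ⬝ᵥ Wᵀ j) := by
      rw [← smul_eq_mul e (Zᵀ j ⬝ᵥ Wᵀ j), ← dotProduct_smul, ← h5, hB, Matrix.add_mulVec,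
        dotProduct_add, Matrix.smul_mulVec, Matrix.one_mulVec, dotProduct_smul, smul_eq_mul,
        ← Matrix.mulVec_mulVec, ← mulVec_dotProduct]
      linarith [zero_le_dotProduct_self (A *ᵥ Zᵀ j)]
    have h7 := le_of_mul_le_mul_left h6 he
    have h8 := zero_le_dotProduct_self (Zᵀ j - Wᵀ j)
    simp only [dotProduct_sub, sub_dotProduct, dotProduct_comm (Wᵀ j) (Zᵀ j)] at h8
    refine Real.abs_le_sqrt ?_
    calc Z i j ^ 2 ≤ ∑ k, Z k j ^ 2 :=
          Finset.single_le_sum (f := fun k => Z k j ^ 2) (fun _ _ => sq_nonneg _)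
            (Finset.mem_univ i)
      _ = Zᵀ j ⬝ᵥ Zᵀ j := by simp [dotProduct, sq]
      _ ≤ Wᵀ j ⬝ᵥ Wᵀ j := by linarith
      _ = _ := by simp [dotProduct, sq]
  rw [h3]
  have h9 : (G - e • W + e • Z) i j - G i j = e * (Z i j - W i j) := by
    simp only [Matrix.add_apply, Matrix.sub_apply, Matrix.smul_apply, smul_eq_mul]; ring
  rw [h9, abs_mul, abs_of_pos he]
  refine mul_le_mul_of_nonneg_left ?_ he.le
  have := abs_sub (Z i j) (W i j)
  linarith

/-- The Moore–Penrose inverse jumps where the rank drops, but it is a pointwise limit of the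
continuous regularizations `(Aᵀ A + e)⁻¹ Aᵀ`. -/
theorem measurable_pinv {α : Type*} [TopologicalSpace α] [MeasurableSpace α] [BorelSpace α]
    {A : α → Matrix (Fin m) (Fin n) ℝ} (hA : Continuous A) (i : Fin n) (j : Fin m) :
    Measurable fun a => pinv (A a) i j := by
  let e : ℕ → ℝ := fun k => 1 / ((k : ℝ) + 1)
  have he : ∀ k, 0 < e k := fun k => Nat.one_div_pos_of_nat
  refine measurable_of_tendsto_metrizable (f := fun (k : ℕ) a =>
    (((A a)ᵀ * A a + e k • (1 : Matrix (Fin n) (Fin n) ℝ))⁻¹ * (A a)ᵀ) i j) (fun k => ?_) ?_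
  · refine Continuous.measurable ?_
    have hB : Continuous fun a => (A a)ᵀ * A a + e k • (1 : Matrix (Fin n) (Fin n) ℝ) :=
      (hA.matrix_transpose.matrix_mul hA).add continuous_const
    have hinv : Continuous fun a =>
        ((A a)ᵀ * A a + e k • (1 : Matrix (Fin n) (Fin n) ℝ))⁻¹ := by
      simp only [Matrix.inv_def, Ring.inverse_eq_inv']
      refine (hB.matrix_det.inv₀ fun a => ?_).smul hB.matrix_adjugate
      exact (transpose_mul_self_add_posDef (A a) (he k)).det_pos.ne'
    exact (hinv.matrix_mul hA.matrix_transpose).matrix_elem i j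
  · rw [tendsto_pi_nhds]
    intro a
    obtain ⟨c, hc⟩ := abs_regularized_sub_pinv_le (A a)
    rw [tendsto_iff_norm_sub_tendsto_zero]
    refine squeeze_zero (fun _ => norm_nonneg _) (fun k => hc (e k) (he k) i j) ?_
    simpa [e] using (tendsto_one_div_add_atTop_nhds_zero_nat (𝕜 := ℝ)).mul_const (c i j)

theorem measurable_lambdaMax_mul {α : Type*} [MeasurableSpace α] {R : Matrix (Fin n) (Fin n) ℝ}
    {G : α → Matrix (Fin n) (Fin n) ℝ} (hR : Rᵀ = R) (hG : ∀ a, (G a).PosSemidef)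
    (hm : ∀ i j, Measurable fun a => G a i j) : Measurable fun a => lambdaMax (R * R * G a) := by
  refine measurable_of_Iic fun c => ?_
  have h1 : Measurable fun a => (fun i j => G a i j : Fin n → Fin n → ℝ) :=
    measurable_pi_iff.mpr fun i => measurable_pi_iff.mpr fun j => hm i j
  have h2 : IsClosed {M : Fin n → Fin n → ℝ |
      0 ≤ c ∧ ∀ v : Fin n → ℝ, v ⬝ᵥ ((R * Matrix.of M * R) *ᵥ v) ≤ c * (v ⬝ᵥ v)} := by
    refine isClosed_const.and ?_
    rw [Set.ofPred_forall]
    refine isClosed_iInter fun v => isClosed_le ?_ continuous_const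
    have : Continuous fun M : Fin n → Fin n → ℝ => (Matrix.of M : Matrix (Fin n) (Fin n) ℝ) :=
      continuous_id
    exact continuous_const.dotProduct (((continuous_const.matrix_mul this).matrix_mul
      continuous_const).matrix_mulVec continuous_const)
  convert! h1 h2.measurableSet using 1
  ext a
  exact lambdaMax_mul_le_iff hR (hG a)

theorem measurable_frobSq_mul {α : Type*} [MeasurableSpace α] {l k : ℕ}
    {A : Matrix (Fin l) (Fin m) ℝ} {B : Matrix (Fin n) (Fin k) ℝ} {G : α → Matrix (Fin m) (Fin n) ℝ}
    (hm : ∀ i j, Measurable fun a => G a i j) : Measurable fun a => frobSq (A * G a * B) := by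
  simp only [frobSq, Matrix.mul_apply]
  fun_prop

end Measurability

/-! ### The data model -/

section Data

variable {dx dy n : ℕ}

theorem continuous_columns :
    Continuous (columns : (Fin n → EuclideanSpace ℝ (Fin dx)) → Matrix (Fin dx) (Fin n) ℝ) := by
  refine continuous_matrix fun i j => ?_
  simp only [columns, Matrix.of_apply]
  fun_prop

theorem continuous_empCov :
    Continuous (empCov : Matrix (Fin dx) (Fin n) ℝ → Matrix (Fin dx) (Fin dx) ℝ) :=
  (Continuous.matrix_mul continuous_id continuous_id.matrix_transpose).const_smul (n : ℝ)⁻¹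

theorem measurable_projPerp_columns (i j : Fin dx) :
    Measurable fun v : Fin n → EuclideanSpace ℝ (Fin dx) => projPerp (columns v) i j := by
  have h := fun k : Fin n => measurable_pinv (continuous_columns (dx := dx) (n := n)) k j
  simp only [projPerp_eq, Matrix.sub_apply, Matrix.mul_apply]
  refine measurable_const.sub (Finset.measurable_sum _ fun k _ => Measurable.mul ?_ (h k))
  exact (continuous_columns.matrix_elem i k).measurable

theorem columns_sub_mul {x : Fin n → EuclideanSpace ℝ (Fin dx)}
    {y : Fin n → EuclideanSpace ℝ (Fin dy)} {A : Matrix (Fin dy) (Fin dx) ℝ} :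
    columns y - A * columns x = columns fun i => y i - Matrix.toEuclideanLin A (x i) := by
  ext j i
  simp [columns, Matrix.mul_apply, Matrix.toLpLin_apply, Matrix.mulVec, dotProduct]

variable {Px : Measure (EuclideanSpace ℝ (Fin dx))}
  {Sε : Matrix (Fin dy) (Fin dy) ℝ} {Astar : Matrix (Fin dy) (Fin dx) ℝ}

theorem measurable_toEuclideanLin (A : Matrix (Fin dy) (Fin dx) ℝ) :
    Measurable (Matrix.toEuclideanLin A) :=
  (LinearMap.continuous_of_finiteDimensional _).measurable

theorem measurable_model (A : Matrix (Fin dy) (Fin dx) ℝ) :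
    Measurable fun p : EuclideanSpace ℝ (Fin dx) × EuclideanSpace ℝ (Fin dy) =>
      (p.1, Matrix.toEuclideanLin A p.1 + p.2) :=
  measurable_fst.prodMk (((measurable_toEuclideanLin A).comp measurable_fst).add measurable_snd)

theorem measurable_noise (A : Matrix (Fin dy) (Fin dx) ℝ) :
    Measurable fun p : EuclideanSpace ℝ (Fin dx) × EuclideanSpace ℝ (Fin dy) =>
      (p.1, p.2 - Matrix.toEuclideanLin A p.1) :=
  measurable_fst.prodMk (measurable_snd.sub ((measurable_toEuclideanLin A).comp measurable_fst))

theorem map_noise_dataLaw :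
    (dataLaw Px Sε Astar).map (fun p => (p.1, p.2 - Matrix.toEuclideanLin Astar p.1))
      = Px.prod (multivariateGaussian 0 Sε) := by
  rw [dataLaw, Measure.map_map (measurable_noise Astar) (measurable_model Astar)]
  convert! Measure.map_id using 2
  ext p <;> simp

/-! ### Population covariance and risk -/

theorem memLp_coord (hPx2 : MemLp (fun x => x) 2 Px) (k : Fin dx) : MemLp (fun x => x k) 2 Px :=
  (EuclideanSpace.proj (𝕜 := ℝ) k).comp_memLp' hPx2

theorem memLp_dotProduct (hPx2 : MemLp (fun x => x) 2 Px) (v : Fin dx → ℝ) :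
    MemLp (fun x : EuclideanSpace ℝ (Fin dx) => v ⬝ᵥ x.ofLp) 2 Px :=
  memLp_finsetSum _ fun k _ => (memLp_coord hPx2 k).const_mul (v k)

theorem integral_dotProduct_sq (hPx2 : MemLp (fun x => x) 2 Px) (v : Fin dx → ℝ) :
    ∫ x, (v ⬝ᵥ x.ofLp) ^ 2 ∂Px = v ⬝ᵥ (popCov Px *ᵥ v) := by
  have hint : ∀ k l, Integrable (fun x : EuclideanSpace ℝ (Fin dx) => v k * (v l * (x k * x l))) Px :=
    fun k l => (((memLp_coord hPx2 k).integrable_mul (memLp_coord hPx2 l)).const_mul _).const_mul _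
  have e : ∀ x : EuclideanSpace ℝ (Fin dx),
      (v ⬝ᵥ x.ofLp) ^ 2 = ∑ k, ∑ l, v k * (v l * (x k * x l)) := by
    intro x
    rw [sq, dotProduct, Finset.sum_mul_sum]
    exact Finset.sum_congr rfl fun k _ => Finset.sum_congr rfl fun l _ => by ring
  simp only [e]
  rw [integral_finsetSum _ fun k _ => integrable_finsetSum _ fun l _ => hint k l]
  simp only [dotProduct, Matrix.mulVec, Finset.mul_sum]
  refine Finset.sum_congr rfl fun k _ => ?_
  rw [integral_finsetSum _ fun l _ => hint k l]
  refine Finset.sum_congr rfl fun l _ => ?_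
  rw [integral_const_mul, integral_const_mul, popCov, Matrix.of_apply]
  ring

theorem popCov_posSemidef (hPx2 : MemLp (fun x => x) 2 Px) : (popCov Px).PosSemidef := by
  refine Matrix.PosSemidef.of_dotProduct_mulVec_nonneg ?_ fun v => ?_
  · ext i j
    simp only [popCov, Matrix.conjTranspose_apply, Matrix.of_apply, star_trivial, mul_comm]
  · rw [star_trivial, ← integral_dotProduct_sq hPx2]
    exact integral_nonneg fun x => sq_nonneg _

theorem frobSq_mul_sqrt {S : Matrix (Fin dx) (Fin dx) ℝ} (hS : S.PosSemidef)
    (D : Matrix (Fin dy) (Fin dx) ℝ) : frobSq (D * CFC.sqrt S) = ∑ j, D j ⬝ᵥ (S *ᵥ D j) := by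
  refine Finset.sum_congr rfl fun j => fun _ => ?_
  have h1 : D j ⬝ᵥ (S *ᵥ D j) = (CFC.sqrt S *ᵥ D j) ⬝ᵥ (CFC.sqrt S *ᵥ D j) := by
    rw [mulVec_dotProduct, sqrt_transpose, Matrix.mulVec_mulVec, sqrt_mul_sqrt hS]
  rw [h1]
  simp only [dotProduct, ← sq]
  refine Finset.sum_congr rfl fun k _ => ?_
  rw [Matrix.mul_apply]
  simp only [Matrix.mulVec, dotProduct]
  congr 1
  refine Finset.sum_congr rfl fun l _ => ?_
  rw [show CFC.sqrt S k l = CFC.sqrt S l k from congrFun (congrFun (sqrt_transpose S) l) k,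
    mul_comm]

theorem risk_eq (A : Matrix (Fin dy) (Fin dx) ℝ) :
    risk (dataLaw Px Sε Astar) A
      = ∫⁻ p, ENNReal.ofReal (∑ j, ((A - Astar) j ⬝ᵥ p.1.ofLp - p.2 j) ^ 2)
        ∂Px.prod (multivariateGaussian 0 Sε) := by
  have hm : Measurable fun p : EuclideanSpace ℝ (Fin dx) × EuclideanSpace ℝ (Fin dy) =>
      ‖Matrix.toEuclideanLin A p.1 - p.2‖ₑ ^ 2 :=
    ((((measurable_toEuclideanLin A).comp measurable_fst).sub measurable_snd).enorm).pow_const 2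
  rw [risk, dataLaw, lintegral_map hm (measurable_model Astar)]
  refine lintegral_congr fun p => ?_
  rw [← ofReal_norm, ← ENNReal.ofReal_pow (norm_nonneg _), EuclideanSpace.norm_sq_eq]
  congr 1
  refine Finset.sum_congr rfl fun j _ => ?_
  rw [Real.norm_eq_abs, sq_abs]
  congr 1
  simp only [PiLp.sub_apply, PiLp.add_apply, Matrix.toLpLin_apply, Matrix.mulVec]
  change _ = (A j - Astar j) ⬝ᵥ p.1.ofLp - _
  rw [sub_dotProduct]
  ring

variable [IsProbabilityMeasure Px]

/-- Expand the square: the cross term is a product of integrals and vanishes because the noise has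
mean zero, while the quadratic term in `x` integrates to the population covariance form. -/
theorem risk_le (hPx2 : MemLp (fun x => x) 2 Px) (A : Matrix (Fin dy) (Fin dx) ℝ) :
    risk (dataLaw Px Sε Astar) A ≤ risk (dataLaw Px Sε Astar) Astar
      + ENNReal.ofReal (frobSq ((A - Astar) * CFC.sqrt (popCov Px))) := by
  set γ := multivariateGaussian 0 Sε
  set D := A - Astar
  have hx := fun j => memLp_dotProduct hPx2 (D j)
  have hγ : MemLp (fun z : EuclideanSpace ℝ (Fin dy) => z) 2 γ := IsGaussian.memLp_two_id
  have hz := fun j => memLp_coord hγ j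
  have h1 : ∀ j, Integrable (fun p : EuclideanSpace ℝ (Fin dx) × EuclideanSpace ℝ (Fin dy) =>
      (D j ⬝ᵥ p.1.ofLp) ^ 2) (Px.prod γ) := fun j => (hx j).integrable_sq.comp_fst γ
  have h2 : ∀ j, Integrable (fun p : EuclideanSpace ℝ (Fin dx) × EuclideanSpace ℝ (Fin dy) =>
      (p.2 j) ^ 2) (Px.prod γ) := fun j => (hz j).integrable_sq.comp_snd Px
  have h3 : ∀ j, Integrable (fun p : EuclideanSpace ℝ (Fin dx) × EuclideanSpace ℝ (Fin dy) =>
      (D j ⬝ᵥ p.1.ofLp) * p.2 j) (Px.prod γ) := fun j =>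
    ((hx j).integrable one_le_two).mul_prod ((hz j).integrable one_le_two)
  have h3' : ∀ j, ∫ p : EuclideanSpace ℝ (Fin dx) × EuclideanSpace ℝ (Fin dy),
      (D j ⬝ᵥ p.1.ofLp) * p.2 j ∂Px.prod γ = 0 := by
    intro j
    have : ∫ z : EuclideanSpace ℝ (Fin dy), z j ∂γ = 0 := by
      have h := (EuclideanSpace.proj (𝕜 := ℝ) j).integral_comp_comm
        (IsGaussian.integrable_id (μ := γ))
      simp only [id, integral_id_multivariateGaussian, γ] at h
      simpa using h
    rw [integral_prod_mul (fun x : EuclideanSpace ℝ (Fin dx) => D j ⬝ᵥ x.ofLp)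
      (fun z : EuclideanSpace ℝ (Fin dy) => z j), this, mul_zero]
  have e : ∀ (j : Fin dy) (p : EuclideanSpace ℝ (Fin dx) × EuclideanSpace ℝ (Fin dy)),
      (D j ⬝ᵥ p.1.ofLp - p.2 j) ^ 2
        = (D j ⬝ᵥ p.1.ofLp) ^ 2 - 2 * ((D j ⬝ᵥ p.1.ofLp) * p.2 j) + (p.2 j) ^ 2 := by
    intro j p; ring
  have h4 : ∀ j, Integrable (fun p : EuclideanSpace ℝ (Fin dx) × EuclideanSpace ℝ (Fin dy) =>
      (D j ⬝ᵥ p.1.ofLp - p.2 j) ^ 2) (Px.prod γ) := by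
    intro j
    simp only [e]
    exact ((h1 j).sub ((h3 j).const_mul 2)).add (h2 j)
  have h5 : ∀ j, ∫ p, (D j ⬝ᵥ p.1.ofLp - p.2 j) ^ 2 ∂Px.prod γ
      = D j ⬝ᵥ (popCov Px *ᵥ D j) + ∫ p, (p.2 j) ^ 2 ∂Px.prod γ := by
    intro j
    have hs : Integrable (fun p : EuclideanSpace ℝ (Fin dx) × EuclideanSpace ℝ (Fin dy) =>
        (D j ⬝ᵥ p.1.ofLp) ^ 2 - 2 * ((D j ⬝ᵥ p.1.ofLp) * p.2 j)) (Px.prod γ) :=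
      (h1 j).sub ((h3 j).const_mul 2)
    simp only [e]
    rw [integral_add hs (h2 j),
      integral_sub (h1 j) ((h3 j).const_mul 2), integral_const_mul, h3', mul_zero, sub_zero,
      integral_fun_fst (fun x : EuclideanSpace ℝ (Fin dx) => (D j ⬝ᵥ x.ofLp) ^ 2),
      integral_dotProduct_sq hPx2]
    simp
  have h6 : risk (dataLaw Px Sε Astar) A
      = ENNReal.ofReal (∑ j, ∫ p, (D j ⬝ᵥ p.1.ofLp - p.2 j) ^ 2 ∂Px.prod γ) := by
    rw [risk_eq, ← integral_finsetSum _ fun j _ => h4 j, ofReal_integral_eq_lintegral_ofReal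
      (integrable_finsetSum _ fun j _ => h4 j)
      (Filter.Eventually.of_forall fun p => Finset.sum_nonneg fun j _ => sq_nonneg _)]
  have h7 : risk (dataLaw Px Sε Astar) Astar
      = ENNReal.ofReal (∑ j, ∫ p, (p.2 j) ^ 2 ∂Px.prod γ) := by
    rw [risk_eq, ← integral_finsetSum _ fun j _ => h2 j, ofReal_integral_eq_lintegral_ofReal
      (integrable_finsetSum _ fun j _ => h2 j)
      (Filter.Eventually.of_forall fun p => Finset.sum_nonneg fun j _ => sq_nonneg _)]
    refine lintegral_congr fun p => ?_
    congr 1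
    refine Finset.sum_congr rfl fun j _ => ?_
    have : (Astar - Astar) j = 0 := by rw [sub_self]; rfl
    rw [this, zero_dotProduct, zero_sub, neg_sq]
  rw [h6, h7, frobSq_mul_sqrt (popCov_posSemidef hPx2), ← ENNReal.ofReal_add
    (Finset.sum_nonneg fun j _ => integral_nonneg fun p => sq_nonneg _)
    (by rw [← frobSq_mul_sqrt (popCov_posSemidef hPx2)]; exact frobSq_nonneg _)]
  refine ENNReal.ofReal_le_ofReal (le_of_eq ?_)
  simp only [h5, Finset.sum_add_distrib]
  exact add_comm _ _

/-! ### Independence of inputs and noise -/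

/-- The inputs and the noise of an i.i.d. sample are independent of each other. -/
theorem lintegral_mul_of_sample {Ω : Type*} [MeasurableSpace Ω] {μ : Measure Ω}
    [IsProbabilityMeasure μ] {x : Fin n → Ω → EuclideanSpace ℝ (Fin dx)}
    {y : Fin n → Ω → EuclideanSpace ℝ (Fin dy)}
    (hindep : iIndepFun (fun i ω => (x i ω, y i ω)) μ)
    (hlaw : ∀ i, HasLaw (fun ω => (x i ω, y i ω)) (dataLaw Px Sε Astar) μ)
    {f : (Fin n → EuclideanSpace ℝ (Fin dx)) → ℝ≥0∞} (hf : Measurable f)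
    {g : (Fin n → EuclideanSpace ℝ (Fin dy)) → ℝ≥0∞} (hg : Measurable g) :
    ∫⁻ ω, f (fun i => x i ω) * g (fun i => y i ω - Matrix.toEuclideanLin Astar (x i ω)) ∂μ
      = (∫⁻ v, f v ∂Measure.pi fun _ => Px)
        * ∫⁻ e, g e ∂Measure.pi fun _ => multivariateGaussian 0 Sε := by
  set Z : Fin n → Ω → EuclideanSpace ℝ (Fin dx) × EuclideanSpace ℝ (Fin dy) :=
    fun i ω => (x i ω, y i ω - Matrix.toEuclideanLin Astar (x i ω)) with hZ
  have hZm : ∀ i, AEMeasurable (Z i) μ := fun i =>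
    (measurable_noise Astar).comp_aemeasurable (hlaw i).aemeasurable
  have hZi : iIndepFun Z μ :=
    hindep.comp (fun _ p => (p.1, p.2 - Matrix.toEuclideanLin Astar p.1))
      fun _ => measurable_noise Astar
  have hZl : ∀ i, μ.map (Z i) = Px.prod (multivariateGaussian 0 Sε) := by
    intro i
    rw [← map_noise_dataLaw (Astar := Astar), ← (hlaw i).map_eq,
      AEMeasurable.map_map_of_aemeasurable (measurable_noise Astar).aemeasurable
        (hlaw i).aemeasurable]
    rfl
  have hpi : μ.map (fun ω i => Z i ω)
      = Measure.pi fun _ => Px.prod (multivariateGaussian 0 Sε) := by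
    rw [hZi.map_fun_eq_pi_map hZm]
    simp only [hZl]
  -- Regrouping the `n` pairs into a pair of `n`-tuples turns a product of product laws into the
  -- product of the input law and the noise law, and the integral factors.
  have hmp := measurePreserving_arrowProdEquivProdArrow (EuclideanSpace ℝ (Fin dx))
    (EuclideanSpace ℝ (Fin dy)) (Fin n) (fun _ => Px) (fun _ => multivariateGaussian 0 Sε)
  have hF : Measurable fun q : (Fin n → EuclideanSpace ℝ (Fin dx)) ×
      (Fin n → EuclideanSpace ℝ (Fin dy)) => f q.1 * g q.2 :=
    (hf.comp measurable_fst).mul (hg.comp measurable_snd)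
  rw [← lintegral_prod_mul hf.aemeasurable hg.aemeasurable, ← hmp.lintegral_comp hF, ← hpi]
  exact (lintegral_map' (hF.comp hmp.measurable).aemeasurable
    (aemeasurable_pi_lambda _ hZm)).symm

theorem lintegral_of_sample {Ω : Type*} [MeasurableSpace Ω] {μ : Measure Ω}
    [IsProbabilityMeasure μ] {x : Fin n → Ω → EuclideanSpace ℝ (Fin dx)}
    {y : Fin n → Ω → EuclideanSpace ℝ (Fin dy)}
    (hindep : iIndepFun (fun i ω => (x i ω, y i ω)) μ)
    (hlaw : ∀ i, HasLaw (fun ω => (x i ω, y i ω)) (dataLaw Px Sε Astar) μ)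
    {f : (Fin n → EuclideanSpace ℝ (Fin dx)) → ℝ≥0∞} (hf : Measurable f) :
    ∫⁻ ω, f (fun i => x i ω) ∂μ = ∫⁻ v, f v ∂Measure.pi fun _ => Px := by
  simpa using lintegral_mul_of_sample hindep hlaw hf (measurable_const (a := (1 : ℝ≥0∞)))

end Data

end LoRA

/-! ### The excess risk bound -/

theorem mainTheorem2 :
    ∃ C : ℝ≥0, ∀ (r n dx dy : ℕ) (_hrn : r < n) (_hnd : n < dx)
      (Px : Measure (EuclideanSpace ℝ (Fin dx))) (_hPx : IsProbabilityMeasure Px)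
      (_hPx2 : MemLp (fun x => x) 2 Px) (_hfull : (LoRA.popCov Px).rank = dx)
      (Sε : Matrix (Fin dy) (Fin dy) ℝ) (_hSε : Sε.PosSemidef)
      (Astar A₀ Δ : Matrix (Fin dy) (Fin dx) ℝ) (_hΔ : Δ = Astar - A₀)
      (Ω : Type*) (_mΩ : MeasurableSpace Ω) (μ : Measure Ω) (_hμ : IsProbabilityMeasure μ)
      (x : Fin n → Ω → EuclideanSpace ℝ (Fin dx)) (y : Fin n → Ω → EuclideanSpace ℝ (Fin dy))
      (_hindep : iIndepFun (fun i ω => (x i ω, y i ω)) μ)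
      (_hlaw : ∀ i, HasLaw (fun ω => (x i ω, y i ω)) (LoRA.dataLaw Px Sε Astar) μ)
      (X : Ω → Matrix (Fin dx) (Fin n) ℝ) (_hX : ∀ ω, X ω = LoRA.columns fun i => x i ω)
      (Y : Ω → Matrix (Fin dy) (Fin n) ℝ) (_hY : ∀ ω, Y ω = LoRA.columns fun i => y i ω)
      (Ahat : Ω → Matrix (Fin dy) (Fin dx) ℝ)
      (_hAhat : ∀ᵐ ω ∂μ, LoRA.IsLoRASolution r A₀ (X ω) (Y ω) (Ahat ω)),
      (∫⁻ ω, LoRA.risk (LoRA.dataLaw Px Sε Astar) (Ahat ω) ∂μ)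
          - LoRA.risk (LoRA.dataLaw Px Sε Astar) Astar
        ≤ C * (
          (∫⁻ ω, ENNReal.ofReal
            (LoRA.frobSq (Δ * LoRA.projPerp (X ω) * CFC.sqrt (LoRA.popCov Px))) ∂μ)
          + ENNReal.ofReal ((r : ℝ) * max (n : ℝ) (dy : ℝ) / n * LoRA.lambdaMax Sε)
            * (∫⁻ ω, ENNReal.ofReal
                (LoRA.lambdaMax (LoRA.popCov Px * LoRA.pinv (LoRA.empCov (X ω)))) ∂μ)
          + ENNReal.ofReal (LoRA.lambdaMax (LoRA.popCov Px)
              * (r * LoRA.singularValue Δ (r + 1) ^ 2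
                + ∑ i ∈ Finset.Icc (r + 1) (min n dy), LoRA.singularValue Δ i ^ 2))
          + ENNReal.ofReal (r * LoRA.singularValue Δ (r + 1) ^ 2)
            * (∫⁻ ω, ENNReal.ofReal
                (LoRA.lambdaMax (LoRA.empCov (X ω))
                  * LoRA.lambdaMax (LoRA.popCov Px * LoRA.pinv (LoRA.empCov (X ω)))) ∂μ)) := by
  -- `55296 = 3 · 16 · 576 · 2`: three error summands, the Frobenius bound `16 r q`, the Gaussian
  -- moment constant, and `n + dy ≤ 2 max n dy`.
  refine ⟨55296, ?_⟩
  intro r n dx dy hrn hnd Px hPx hPx2 _ Sε hSε Astar A₀ Δ hΔ Ω mΩ μ hμ x y hindep hlaw X hX Y hY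
    Ahat hAhat
  have hn : 0 < n := by omega
  have hn' : (0 : ℝ) < n := Nat.cast_pos.mpr hn
  have hCov := LoRA.popCov_posSemidef hPx2
  set R := CFC.sqrt (LoRA.popCov Px)
  have hRt : Rᵀ = R := LoRA.sqrt_transpose _
  have hRR : R * R = LoRA.popCov Px := LoRA.sqrt_mul_sqrt hCov
  set σ := LoRA.singularValue Δ (r + 1) ^ 2
  set tail := LoRA.lambdaMax (LoRA.popCov Px) * (r * σ
    + ∑ i ∈ Finset.Icc (r + 1) (min n dy), LoRA.singularValue Δ i ^ 2)
  have hσ : 0 ≤ σ := sq_nonneg _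
  have htail : 0 ≤ tail := mul_nonneg (LoRA.lambdaMax_nonneg hCov)
    (add_nonneg (by positivity) (Finset.sum_nonneg fun i _ => sq_nonneg _))
  have hlε := LoRA.lambdaMax_nonneg hSε
  let fa : (Fin n → EuclideanSpace ℝ (Fin dx)) → ℝ≥0∞ := fun v =>
    ENNReal.ofReal (LoRA.frobSq (Δ * LoRA.projPerp (LoRA.columns v) * R))
  let fl : (Fin n → EuclideanSpace ℝ (Fin dx)) → ℝ := fun v =>
    LoRA.lambdaMax (LoRA.popCov Px * LoRA.pinv (LoRA.empCov (LoRA.columns v)))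
  let fL : (Fin n → EuclideanSpace ℝ (Fin dx)) → ℝ := fun v =>
    LoRA.lambdaMax (LoRA.empCov (LoRA.columns v))
  let g : (Fin n → EuclideanSpace ℝ (Fin dy)) → ℝ≥0∞ := fun e =>
    ENNReal.ofReal (‖LoRA.columnsCLM e‖ ^ 2)
  have hfa : Measurable fa :=
    (LoRA.measurable_frobSq_mul LoRA.measurable_projPerp_columns).ennreal_ofReal
  have hfl : Measurable fl := by
    simp only [fl, ← hRR]
    exact LoRA.measurable_lambdaMax_mul hRt
      (fun v => LoRA.pinv_posSemidef (LoRA.empCov_posSemidef _))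
      (LoRA.measurable_pinv (LoRA.continuous_empCov.comp LoRA.continuous_columns))
  have hg : Measurable g :=
    (LoRA.continuous_columnsCLM.norm.pow 2).measurable.ennreal_ofReal
  have hfl0 : ∀ v, 0 ≤ fl v := fun v => by
    simp only [fl, ← hRR]
    exact LoRA.lambdaMax_mul_nonneg hRt (LoRA.pinv_posSemidef (LoRA.empCov_posSemidef _))
  have hfL0 : ∀ v, 0 ≤ fL v := fun v => LoRA.lambdaMax_nonneg (LoRA.empCov_posSemidef _)
  let xs : Ω → Fin n → EuclideanSpace ℝ (Fin dx) := fun ω i => x i ω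
  let es : Ω → Fin n → EuclideanSpace ℝ (Fin dy) := fun ω i =>
    y i ω - Matrix.toEuclideanLin Astar (x i ω)
  have hxs : AEMeasurable xs μ := aemeasurable_pi_lambda _ fun i =>
    measurable_fst.comp_aemeasurable (hlaw i).aemeasurable
  have hes : AEMeasurable es μ := aemeasurable_pi_lambda _ fun i =>
    (measurable_snd.comp (LoRA.measurable_noise Astar)).comp_aemeasurable (hlaw i).aemeasurable
  -- The summand with `fL` stands last, so splitting the integral of the sum never asks for its
  -- measurability.
  have hpt : ∀ᵐ ω ∂μ, LoRA.risk (LoRA.dataLaw Px Sε Astar) (Ahat ω)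
      ≤ LoRA.risk (LoRA.dataLaw Px Sε Astar) Astar + (3 * fa (xs ω)
        + (3 * ENNReal.ofReal tail
        + (ENNReal.ofReal (48 * r / n) * (ENNReal.ofReal (fl (xs ω)) * g (es ω))
        + 48 * (ENNReal.ofReal (r * σ) * ENNReal.ofReal (fL (xs ω) * fl (xs ω)))))) := by
    filter_upwards [hAhat] with ω hω
    refine (LoRA.risk_le hPx2 (Ahat ω)).trans (add_le_add_right ?_ _)
    have hE : LoRA.SqBound (Y ω - Astar * X ω) (‖LoRA.columnsCLM (es ω)‖ ^ 2) := by
      rw [hX, hY, LoRA.columns_sub_mul]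
      exact LoRA.sqBound_columns _
    have h := LoRA.excess_le hrn hω hCov (sq_nonneg _) hE
    rw [← hΔ, hX] at h
    refine (ENNReal.ofReal_le_ofReal h).trans (le_of_eq ?_)
    have h1 := LoRA.frobSq_nonneg (Δ * LoRA.projPerp (LoRA.columns (xs ω)) * R)
    have h2 := hfl0 (xs ω)
    have h3 := hfL0 (xs ω)
    simp only [fa, g]
    rw [← ENNReal.ofReal_mul h2, ← ENNReal.ofReal_mul (by positivity),
      ← ENNReal.ofReal_mul (by positivity),
      show (48 : ℝ≥0∞) = ENNReal.ofReal 48 by simp, show (3 : ℝ≥0∞) = ENNReal.ofReal 3 by simp,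
      ← ENNReal.ofReal_mul (by positivity), ← ENNReal.ofReal_mul (by positivity),
      ← ENNReal.ofReal_mul (by positivity), ← ENNReal.ofReal_add (by positivity) (by positivity),
      ← ENNReal.ofReal_add (by positivity) (by positivity),
      ← ENNReal.ofReal_add (by positivity) (by positivity)]
    congr 1
    simp only [fl, fL, xs]
    ring
  rw [tsub_le_iff_left]
  -- Monotonicity of the lower integral asks no measurability of `Ahat`, so an arbitrary choice
  -- among tied truncations is harmless.
  refine (lintegral_mono_ae hpt).trans ?_
  have hfax : AEMeasurable (fun ω => fa (xs ω)) μ := hfa.comp_aemeasurable hxs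
  have hsplit : ∫⁻ ω, ENNReal.ofReal (fl (xs ω)) * g (es ω) ∂μ
      = (∫⁻ ω, ENNReal.ofReal (fl (xs ω)) ∂μ)
        * ∫⁻ e, g e ∂Measure.pi fun _ => multivariateGaussian 0 Sε := by
    rw [LoRA.lintegral_of_sample hindep hlaw hfl.ennreal_ofReal]
    exact LoRA.lintegral_mul_of_sample hindep hlaw hfl.ennreal_ofReal hg
  have hprod : AEMeasurable (fun ω => ENNReal.ofReal (fl (xs ω)) * g (es ω)) μ :=
    (hfl.comp_aemeasurable hxs).ennreal_ofReal.mul (hg.comp_aemeasurable hes)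
  rw [lintegral_add_left measurable_const, lintegral_const, measure_univ, mul_one,
    lintegral_add_left' (hfax.const_mul 3),
    lintegral_add_left measurable_const, lintegral_const, measure_univ, mul_one,
    lintegral_add_left' (hprod.const_mul _),
    lintegral_const_mul' _ _ (by simp), lintegral_const_mul' _ _ ENNReal.ofReal_ne_top,
    lintegral_const_mul' _ _ (by simp), lintegral_const_mul' _ _ ENNReal.ofReal_ne_top,
    hsplit]
  refine add_le_add_right ?_ _
  have hgb : ENNReal.ofReal (48 * r / n) * (∫⁻ e, g e ∂Measure.pi fun _ => multivariateGaussian 0 Sε)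
      ≤ 55296 * ENNReal.ofReal ((r : ℝ) * max (n : ℝ) (dy : ℝ) / n * LoRA.lambdaMax Sε) := by
    refine (mul_le_mul_right (LoRA.lintegral_opNorm_sq_le hSε hn) _).trans ?_
    rw [← ENNReal.ofReal_mul (by positivity),
      show (55296 : ℝ≥0∞) = ENNReal.ofReal 55296 by simp, ← ENNReal.ofReal_mul (by positivity)]
    refine ENNReal.ofReal_le_ofReal ?_
    have h1 : (n : ℝ) + dy ≤ 2 * max (n : ℝ) dy := by
      linarith [le_max_left (n : ℝ) dy, le_max_right (n : ℝ) dy]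
    calc 48 * (r : ℝ) / n * (576 * (n + dy) * LoRA.lambdaMax Sε)
        = 27648 * (r / n * LoRA.lambdaMax Sε) * (n + dy) := by ring
      _ ≤ 27648 * (r / n * LoRA.lambdaMax Sε) * (2 * max (n : ℝ) dy) :=
        mul_le_mul_of_nonneg_left h1 (by positivity)
      _ = _ := by ring
  simp only [hX, ENNReal.coe_ofNat]
  rw [mul_add, mul_add, mul_add, add_assoc, add_assoc]
  refine add_le_add ?_ ?_
  · exact mul_le_mul_left (by norm_num) _
  rw [add_left_comm]
  refine add_le_add ?_ (add_le_add ?_ ?_)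
  · calc _ = (ENNReal.ofReal (48 * r / n) * ∫⁻ e, g e ∂Measure.pi fun _ =>
          multivariateGaussian 0 Sε) * ∫⁻ ω, ENNReal.ofReal (fl (xs ω)) ∂μ := by ring
      _ ≤ _ := mul_le_mul_left hgb _
      _ = _ := mul_assoc _ _ _
  · exact mul_le_mul_left (by norm_num) _
  · exact mul_le_mul_left (by norm_num) _
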